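/- Let $n\ge 1$, let $p_1,\dots,p_n$ be pairwise distinct points in the Euclidean plane, and let $\Pi=(p_1,\dots,p_n)$ be the polygonal path through them in this order, of weight $\omega(\Pi)=\sum_{i=1}^{n-1}|p_ip_{i+1}|$. For a spanning tree $T$ of the complete Euclidean graph on $P=\{p_1,\dots,p_n\}$, let $\omega(T)$ be the sum of the lengths of its edges; call $T$ a $\frac{2\pi}{3}$-spanning tree of $P$ if, at every vertex, all edges of $T$ incident to that vertex are contained in a closed cone of angle $\frac{2\pi}{3}$ with apex at the vertex. There is an algorithm for the real RAM (a random access machine with unit-cost exact real operations $+,-,\times,/,\sqrt{\ }$ and comparisons, unit-cost addition, subtraction and comparison of natural numbers, which serve as indices, and no conversion from real numbers to natural numbers) that, given $n$ and the coordinates of $p_1,\dots,p_n$, constructs in $O(n)$ time the list of the edges of a $\frac{2\pi}{3}$-spanning tree $T$ of $P$ such that (i) $\omega(T)\le 2\,\omega(\Pi)$, and (ii) $T$ is a 3-hop spanner of $\Pi$: for every edge $\{p_i,p_{i+1}\}$ of $\Pi$, there is a path in $T$ between $p_i$ and $p_{i+1}$ with at most 3 edges. -/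

import Mathlib

/-- The Euclidean plane. -/
abbrev Plane : Type := EuclideanSpace ℝ (Fin 2)

namespace BoundedAngle

/-- The weight of the polygonal path `(p 0, …, p (n-1))`: the sum of the lengths of its edges. -/
noncomputable def pathWeight {n : ℕ} (p : Fin n → Plane) : ℝ :=
  ∑ i : Fin (n - 1), dist (p ⟨i.1, by omega⟩) (p ⟨i.1 + 1, by omega⟩)

open Classical in
/-- The weight of a graph drawn on the points `p`: the sum of the lengths of its edges. -/
noncomputable def graphWeight {n : ℕ} (p : Fin n → Plane) (T : SimpleGraph (Fin n)) : ℝ :=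
  ∑ e ∈ T.edgeFinset, Sym2.lift ⟨fun i j => dist (p i) (p j), fun _ _ => dist_comm _ _⟩ e

/-- For every vertex, the edges incident to it lie in a closed cone of angle `α` with apex at that
vertex (a cone with axis `d` and angle `α` consists of the directions that make an angle of at
most `α / 2` with `d`). -/
def AngleBounded {n : ℕ} (α : ℝ) (p : Fin n → Plane) (T : SimpleGraph (Fin n)) : Prop :=
  ∀ i, ∃ d : Plane, d ≠ 0 ∧ ∀ j, T.Adj i j → InnerProductGeometry.angle d (p j - p i) ≤ α / 2

/-- An `α`-spanning tree of the points `p i`, for `0 < α < 2π`: a spanning tree of the complete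
Euclidean graph over these points in which the edges at each vertex span an angle at most `α`. -/
def IsAngleSpanningTree {n : ℕ} (α : ℝ) (p : Fin n → Plane) (T : SimpleGraph (Fin n)) : Prop :=
  T.IsTree ∧ AngleBounded α p T

/-- `T` is a `k`-hop spanner of the path `(p 0, …, p (n-1))`: the end vertices of each edge of the
path are joined in `T` by a path with at most `k` edges. -/
def IsHopSpannerOfPath {n : ℕ} (k : ℕ) (T : SimpleGraph (Fin n)) : Prop :=
  ∀ i j, (SimpleGraph.pathGraph n).Adj i j → ∃ w : T.Walk i j, w.IsPath ∧ w.length ≤ k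

end BoundedAngle

/-! ### The real RAM

A random access machine with two separate memories, one whose cells hold natural numbers and one
whose cells hold exact real numbers. Each memory is divided into arrays `0, 1, 2, …` with cells
`0, 1, 2, …`; a program mentions finitely many arrays by name, and cells are addressed indirectly
through computed natural numbers. Natural numbers are added and subtracted; the real operations
are `+`, `-`, `*`, `/`, `√`, and comparison. The only constants are natural numbers, and no operation
converts between the two memories (in particular, there is no floor function). Every elementary
operation takes one unit of time. -/

namespace RealRAM

/-- The content of the memory. -/
structure State where
  nat : ℕ → ℕ → ℕ
  real : ℕ → ℕ → ℝ

/-- Store `v` in cell `i` of array `a` of natural numbers. -/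
def State.writeNat (s : State) (a i v : ℕ) : State :=
  { s with nat := fun b j => if b = a ∧ j = i then v else s.nat b j }

/-- Store `v` in cell `i` of array `a` of real numbers. -/
noncomputable def State.writeReal (s : State) (a i : ℕ) (v : ℝ) : State :=
  { s with real := fun b j => if b = a ∧ j = i then v else s.real b j }

/-- Expressions for natural numbers. `read a e` is the content of cell `e` of array `a`. -/
inductive NatExpr where
  | const (c : ℕ)
  | read (a : ℕ) (e : NatExpr)
  | add (e₁ e₂ : NatExpr)
  | sub (e₁ e₂ : NatExpr)

namespace NatExpr

/-- The value of an expression (subtraction is truncated at `0`). -/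
def eval (s : State) : NatExpr → ℕ
  | const c => c
  | read a e => s.nat a (e.eval s)
  | add e₁ e₂ => e₁.eval s + e₂.eval s
  | sub e₁ e₂ => e₁.eval s - e₂.eval s

/-- The number of operations that the evaluation takes. -/
def cost : NatExpr → ℕ
  | const _ => 1
  | read _ e => e.cost + 1
  | add e₁ e₂ => e₁.cost + e₂.cost + 1
  | sub e₁ e₂ => e₁.cost + e₂.cost + 1

end NatExpr

/-- Expressions for real numbers. `read a e` is the content of cell `e` of array `a`. -/
inductive RealExpr where
  | const (c : ℕ)
  | read (a : ℕ) (e : NatExpr)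
  | add (e₁ e₂ : RealExpr)
  | sub (e₁ e₂ : RealExpr)
  | mul (e₁ e₂ : RealExpr)
  | div (e₁ e₂ : RealExpr)
  | sqrt (e : RealExpr)

namespace RealExpr

/-- The value of an expression. Division by `0` and the square root of a negative number give `0`
(a program can test for both beforehand). -/
noncomputable def eval (s : State) : RealExpr → ℝ
  | const c => (c : ℝ)
  | read a e => s.real a (e.eval s)
  | add e₁ e₂ => e₁.eval s + e₂.eval s
  | sub e₁ e₂ => e₁.eval s - e₂.eval s
  | mul e₁ e₂ => e₁.eval s * e₂.eval s
  | div e₁ e₂ => e₁.eval s / e₂.eval s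
  | sqrt e => Real.sqrt (e.eval s)

/-- The number of operations that the evaluation takes. -/
def cost : RealExpr → ℕ
  | const _ => 1
  | read _ e => e.cost + 1
  | add e₁ e₂ => e₁.cost + e₂.cost + 1
  | sub e₁ e₂ => e₁.cost + e₂.cost + 1
  | mul e₁ e₂ => e₁.cost + e₂.cost + 1
  | div e₁ e₂ => e₁.cost + e₂.cost + 1
  | sqrt e => e.cost + 1

end RealExpr

/-- Tests. -/
inductive Test where
  | natLe (e₁ e₂ : NatExpr)
  | realLe (e₁ e₂ : RealExpr)
  | not (b : Test)
  | and (b₁ b₂ : Test)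

namespace Test

/-- The truth value of a test. -/
def Holds (s : State) : Test → Prop
  | natLe e₁ e₂ => e₁.eval s ≤ e₂.eval s
  | realLe e₁ e₂ => e₁.eval s ≤ e₂.eval s
  | not b => ¬ b.Holds s
  | and b₁ b₂ => b₁.Holds s ∧ b₂.Holds s

/-- The number of operations that the test takes. -/
def cost : Test → ℕ
  | natLe e₁ e₂ => e₁.cost + e₂.cost + 1
  | realLe e₁ e₂ => e₁.cost + e₂.cost + 1
  | not b => b.cost + 1
  | and b₁ b₂ => b₁.cost + b₂.cost + 1

end Test

/-- Programs. `setNat a i e` and `setReal a i e` store the value of `e` in cell `i` of array `a`. -/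
inductive Program where
  | skip
  | setNat (a : ℕ) (i e : NatExpr)
  | setReal (a : ℕ) (i : NatExpr) (e : RealExpr)
  | seq (P Q : Program)
  | cond (b : Test) (P Q : Program)
  | loop (b : Test) (P : Program)

/-- `Runs P s s' t`: started in the state `s`, the program `P` halts in the state `s'` after
`t` steps. The program `loop b P` repeats `P` as long as `b` holds. -/
inductive Runs : Program → State → State → ℕ → Prop where
  | skip (s : State) : Runs .skip s s 1
  | setNat (a : ℕ) (i e : NatExpr) (s : State) :
      Runs (.setNat a i e) s (s.writeNat a (i.eval s) (e.eval s)) (i.cost + e.cost + 1)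
  | setReal (a : ℕ) (i : NatExpr) (e : RealExpr) (s : State) :
      Runs (.setReal a i e) s (s.writeReal a (i.eval s) (e.eval s)) (i.cost + e.cost + 1)
  | seq {P Q : Program} {s₁ s₂ s₃ : State} {t₁ t₂ : ℕ}
      (hP : Runs P s₁ s₂ t₁) (hQ : Runs Q s₂ s₃ t₂) : Runs (.seq P Q) s₁ s₃ (t₁ + t₂)
  | condTrue {b : Test} {P : Program} (Q : Program) {s s' : State} {t : ℕ}
      (hb : b.Holds s) (hP : Runs P s s' t) : Runs (.cond b P Q) s s' (b.cost + t + 1)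
  | condFalse {b : Test} (P : Program) {Q : Program} {s s' : State} {t : ℕ}
      (hb : ¬ b.Holds s) (hQ : Runs Q s s' t) : Runs (.cond b P Q) s s' (b.cost + t + 1)
  | loopDone {b : Test} (P : Program) {s : State}
      (hb : ¬ b.Holds s) : Runs (.loop b P) s s (b.cost + 1)
  | loopStep {b : Test} {P : Program} {s₁ s₂ s₃ : State} {t₁ t₂ : ℕ}
      (hb : b.Holds s₁) (hP : Runs P s₁ s₂ t₁) (hl : Runs (.loop b P) s₂ s₃ t₂) :
      Runs (.loop b P) s₁ s₃ (b.cost + t₁ + t₂ + 1)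

/-- Execution is deterministic: the final state and the number of steps are unique. -/
theorem Runs.unique {P : Program} {s s₁ s₂ : State} {t₁ t₂ : ℕ}
    (h₁ : Runs P s s₁ t₁) (h₂ : Runs P s s₂ t₂) : s₁ = s₂ ∧ t₁ = t₂ := by
  induction h₁ generalizing s₂ t₂ with
  | skip | setNat | setReal => cases h₂; exact ⟨rfl, rfl⟩
  | seq _ _ ihP ihQ =>
    cases h₂ with
    | seq hP hQ =>
      obtain ⟨rfl, rfl⟩ := ihP hP
      obtain ⟨rfl, rfl⟩ := ihQ hQ
      exact ⟨rfl, rfl⟩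
  | condTrue _ hb _ ih =>
    cases h₂ with
    | condTrue _ _ h => obtain ⟨rfl, rfl⟩ := ih h; exact ⟨rfl, rfl⟩
    | condFalse _ hb' _ => exact absurd hb hb'
  | condFalse _ hb _ ih =>
    cases h₂ with
    | condTrue _ hb' _ => exact absurd hb' hb
    | condFalse _ _ h => obtain ⟨rfl, rfl⟩ := ih h; exact ⟨rfl, rfl⟩
  | loopDone _ hb =>
    cases h₂ with
    | loopDone _ _ => exact ⟨rfl, rfl⟩
    | loopStep hb' _ _ => exact absurd hb' hb
  | loopStep hb _ _ ihP ihl =>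
    cases h₂ with
    | loopDone _ hb' => exact absurd hb hb'
    | loopStep _ hP hl =>
      obtain ⟨rfl, rfl⟩ := ihP hP
      obtain ⟨rfl, rfl⟩ := ihl hl
      exact ⟨rfl, rfl⟩

/-- The initial state for a sequence of `n` points: `n` is in cell `0` of array `0` of natural
numbers, the coordinates of the `i`-th point are in cell `i` of the arrays `0` and `1` of real
numbers, and all other cells hold `0`. -/
noncomputable def inputPoints {n : ℕ} (p : Fin n → Plane) : State where
  nat := fun a i => if a = 0 ∧ i = 0 then n else 0
  real := fun a i =>
    if h : i < n then (if a = 0 then p ⟨i, h⟩ 0 else if a = 1 then p ⟨i, h⟩ 1 else 0) else 0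

/-- The graph on `n` vertices that a state lists as output. Its `n - 1` edges are listed in the
arrays `1` and `2` of natural numbers: edge `k` joins the vertices whose numbers are in cell `k`
of these two arrays. -/
def outputGraph (n : ℕ) (s : State) : SimpleGraph (Fin n) :=
  SimpleGraph.fromRel fun i j => ∃ k, k < n - 1 ∧ s.nat 1 k = i.1 ∧ s.nat 2 k = j.1

end RealRAM

/-! ### Angle conditions and the linking of two pairs of points -/

namespace BoundedAngle

open scoped RealInnerProductSpace

/-! Split the path edges by the parity of their index. The lighter class is kept; its edges,
together with at most one single point at each end, are the blocks. Every edge of the heavier class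
is replaced by a link, one of the up to four edges between the two blocks that it joins. Contracting
the blocks turns the links into a path, so the result is a spanning tree, and a replaced edge is
bridged by block edge, link, block edge: 3 hops. By the triangle inequality a link costs at most its
path edge plus the two neighboring block edges. With H and L the weights of the two classes, the
total is at most H + 3L ≤ 2(H + L).

The angle condition concerns only a point, its mate in the block, and at most two links. One link
needs an angle of at most 2π/3 with the block edge (`Wide`); two links at the same point each need
at most π/3 (`Narrow`), and then the direction of the mate is the axis of the cone. The geometric
core is `exists_link`: between two blocks there is always either a link that is narrow at its new
end, or a link to each of the two new points that is wide there.

In the second case the right link depends on which point the following link occupies. Hence the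
algorithm sweeps forward and stores both options (`LinkChoice`), then backward, where the following
link is already known (`LinkChoice.isLink`). Both sweeps do constant work per block. -/

/-- The points `m` and `z` are seen from `o` under an angle of at most `π / 3`. -/
def Narrow (o m z : Plane) : Prop := dist m o * dist z o ≤ 2 * ⟪m - o, z - o⟫

/-- The points `m` and `z` are seen from `o` under an angle of at most `2π / 3`. -/
def Wide (o m z : Plane) : Prop := 0 ≤ 2 * ⟪m - o, z - o⟫ + dist m o * dist z o

theorem dist_sq_eq (o m z : Plane) :
    dist m z ^ 2 = dist m o ^ 2 + dist z o ^ 2 - 2 * ⟪m - o, z - o⟫ := by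
  have h := norm_sub_sq_real (m - o) (z - o)
  rw [sub_sub_sub_cancel_right] at h
  rw [dist_eq_norm, dist_eq_norm, dist_eq_norm, h]
  ring

theorem Narrow.wide {o m z : Plane} (h : Narrow o m z) : Wide o m z := by
  have h₁ : 0 ≤ dist m o * dist z o := by positivity
  unfold Narrow at h
  unfold Wide
  linarith

/-- By the law of cosines, an angle above 2π/3 between sides x and y makes the square of the third
side exceed x² + xy + y², which is at least (x + y/2)². These linear bounds are all that
`exists_link` uses of the geometry. -/
theorem lt_dist_of_not_wide {o m z : Plane} (h : ¬ Wide o m z) :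
    dist m o + dist z o / 2 < dist m z ∧ dist z o + dist m o / 2 < dist m z := by
  have h₁ := dist_sq_eq o m z
  rw [Wide, not_le] at h
  have hm : 0 ≤ dist m o := dist_nonneg
  have hz : 0 ≤ dist z o := dist_nonneg
  constructor <;> refine lt_of_pow_lt_pow_left₀ 2 dist_nonneg ?_ <;>
    nlinarith [sq_nonneg (dist m o), sq_nonneg (dist z o)]

/-- As before, now with x² - xy + y² ≥ (x - y/2)². -/
theorem lt_dist_of_not_narrow {o m z : Plane} (h : ¬ Narrow o m z) :
    dist m o - dist z o / 2 < dist m z ∧ dist z o - dist m o / 2 < dist m z := by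
  have h₁ := dist_sq_eq o m z
  rw [Narrow, not_le] at h
  have hm : 0 ≤ dist m o := dist_nonneg
  have hz : 0 ≤ dist z o := dist_nonneg
  constructor <;> refine lt_of_pow_lt_pow_left₀ 2 dist_nonneg ?_ <;>
    nlinarith [sq_nonneg (dist m o), sq_nonneg (dist z o)]

/-- The edge from `x ∈ {a, b}` to `z` is compatible with all earlier edges, provided that these
use `a` within a cone around `b` of angle `2π / 3` only, and do not use `b`. -/
def Fits {ι : Type*} (q : ι → Plane) (a b x z : ι) : Prop :=
  (x = a ∧ Narrow (q a) (q b) (q z)) ∨ (x = b ∧ Wide (q b) (q a) (q z))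

/-- Two pairs of points can be linked by an edge that fits to the first pair and is narrow at the
second pair, or else by such edges to both points of the second pair that are wide there. -/
theorem exists_link (a b c d : Plane) :
    ((Narrow a b c ∧ Narrow c d a) ∨ (Wide b a c ∧ Narrow c d b)) ∨
    ((Narrow a b d ∧ Narrow d c a) ∨ (Wide b a d ∧ Narrow d c b)) ∨
    (((Narrow a b c ∧ Wide c d a) ∨ (Wide b a c ∧ Wide c d b)) ∧
      ((Narrow a b d ∧ Wide d c a) ∨ (Wide b a d ∧ Wide d c b))) := by
  -- A triangle with an angle above 2π/3 has its other angles below π/3.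
  have cov : ∀ o m z : Plane, ¬ Wide o m z → Narrow m o z := fun o m z h => by
    by_contra h'
    have h₁ := (lt_dist_of_not_wide h).2
    have h₂ := (lt_dist_of_not_narrow h').2
    rw [dist_comm o m, dist_comm z m, dist_comm o z] at h₂
    linarith [dist_nonneg (x := m) (y := o), dist_comm o z]
  -- Adding the four distance bounds, the halves of `ab` and `cd` cancel and both sides become `ac +
  -- ad + bc + bd`, so the strict inequality is absurd.
  have spiral : ∀ a b c d : Plane,
      ¬ Wide a b c → ¬ Wide d c a → ¬ Narrow c d b → ¬ Narrow b a d → False := by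
    intro a b c d h₁ h₂ h₃ h₄
    have g₁ := (lt_dist_of_not_wide h₁).2
    have g₂ := (lt_dist_of_not_wide h₂).2
    have g₃ := (lt_dist_of_not_narrow h₃).2
    have g₄ := (lt_dist_of_not_narrow h₄).2
    linarith [dist_comm a b, dist_comm a c, dist_comm a d, dist_comm b c, dist_comm b d,
      dist_comm c d]
  have s₁ := spiral b a c d
  have s₂ := spiral b a d c
  have s₃ := spiral c d a b
  have s₄ := spiral d c a b
  have c₁ := cov b a c
  have c₂ := cov b a d
  have c₃ := cov c d a
  have c₄ := cov c d b
  have c₅ := cov d c a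
  have c₆ := cov d c b
  clear cov spiral
  grind

end BoundedAngle

/-! ### A linkage gives a tree with bounded angles that is a 3-hop spanner -/

namespace BoundedAngle

open scoped RealInnerProductSpace

theorem angle_le_pi_div_three {d u : Plane} (hd : d ≠ 0) (hu : u ≠ 0)
    (h : ‖d‖ * ‖u‖ ≤ 2 * ⟪d, u⟫) : InnerProductGeometry.angle d u ≤ Real.pi / 3 := by
  have h₁ : Real.arccos (1 / 2) = Real.pi / 3 := by
    rw [← Real.cos_pi_div_three]
    exact Real.arccos_cos (by positivity) (by linarith [Real.pi_pos])
  rw [InnerProductGeometry.angle, ← h₁]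
  apply Real.arccos_le_arccos
  rw [le_div_iff₀ (mul_pos (norm_pos_iff.2 hd) (norm_pos_iff.2 hu))]
  linarith

/-- The bisector is `‖w‖ • u + ‖u‖ • w`. With S = `‖u‖ * ‖w‖ + ⟪u, w⟫`, its squared norm is `2 * ‖u‖
* ‖w‖ * S`, and the hypothesis says `‖u‖ * ‖w‖ ≤ 2 * S`; so its norm is at most `2 * S`, which is
what `angle_le_pi_div_three` asks on both sides. -/
theorem exists_bisector {u w : Plane} (hu : u ≠ 0) (hw : w ≠ 0)
    (h : 0 ≤ 2 * ⟪u, w⟫ + ‖u‖ * ‖w‖) :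
    ∃ d : Plane, d ≠ 0 ∧ InnerProductGeometry.angle d u ≤ Real.pi / 3 ∧
      InnerProductGeometry.angle d w ≤ Real.pi / 3 := by
  have hu' := norm_pos_iff.2 hu
  have hw' := norm_pos_iff.2 hw
  have huw := mul_pos hu' hw'
  set d : Plane := ‖w‖ • u + ‖u‖ • w with hd
  have h₁ : ⟪d, u⟫ = ‖u‖ * (‖u‖ * ‖w‖ + ⟪u, w⟫) := by
    rw [hd, inner_add_left, real_inner_smul_left, real_inner_smul_left,
      real_inner_self_eq_norm_sq, real_inner_comm]
    ring
  have h₂ : ⟪d, w⟫ = ‖w‖ * (‖u‖ * ‖w‖ + ⟪u, w⟫) := by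
    rw [hd, inner_add_left, real_inner_smul_left, real_inner_smul_left,
      real_inner_self_eq_norm_sq]
    ring
  have h₃ : ‖d‖ ^ 2 = 2 * (‖u‖ * ‖w‖) * (‖u‖ * ‖w‖ + ⟪u, w⟫) := by
    rw [← real_inner_self_eq_norm_sq]
    nth_rw 2 [hd]
    rw [inner_add_right, real_inner_smul_right, real_inner_smul_right, h₁, h₂]
    ring
  have h₄ : ‖d‖ ≤ 2 * (‖u‖ * ‖w‖ + ⟪u, w⟫) := by
    refine le_of_sq_le_sq ?_ (by linarith)
    rw [h₃]
    nlinarith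
  have h₅ : d ≠ 0 := by
    intro h0
    rw [h0, norm_zero] at h₃
    nlinarith
  refine ⟨d, h₅, angle_le_pi_div_three h₅ hu ?_, angle_le_pi_div_three h₅ hw ?_⟩
  · rw [h₁]; nlinarith
  · rw [h₂]; nlinarith

/-- Points `m` and `x` that are wide at `v` lie in a closed cone of angle `2π / 3` with apex `v`. -/
theorem Wide.exists_cone {v m x : Plane} (hm : m ≠ v) (hx : x ≠ v) (h : Wide v m x) :
    ∃ d : Plane, d ≠ 0 ∧ InnerProductGeometry.angle d (m - v) ≤ Real.pi / 3 ∧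
      InnerProductGeometry.angle d (x - v) ≤ Real.pi / 3 := by
  refine exists_bisector (sub_ne_zero.2 hm) (sub_ne_zero.2 hx) ?_
  rwa [Wide, dist_eq_norm, dist_eq_norm] at h

theorem Narrow.angle_le {v m x : Plane} (hm : m ≠ v) (hx : x ≠ v) (h : Narrow v m x) :
    InnerProductGeometry.angle (m - v) (x - v) ≤ Real.pi / 3 := by
  refine angle_le_pi_div_three (sub_ne_zero.2 hm) (sub_ne_zero.2 hx) ?_
  rwa [Narrow, dist_eq_norm, dist_eq_norm] at h

/-- Two sequences `a`, `b` that list the edges of a spanning tree of the points `q 0, …, q (n-1)`: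
edge `i` is the path edge `{i, i + 1}` if `i` is not congruent to `t` modulo `2`; these path edges
and the remaining end vertices are the blocks. If `i` is congruent to `t`, edge `i` joins the
consecutive blocks `{i - 1, i}` and `{i + 1, i + 2}`. -/
structure IsLinkage (n t : ℕ) (q : ℕ → Plane) (a b : ℕ → ℕ) : Prop where
  lt_two : t < 2
  mate : ∀ i, i + 1 < n → i % 2 ≠ t → a i = i ∧ b i = i + 1
  left : ∀ i, i + 1 < n → i % 2 = t → a i = i - 1 ∨ a i = i
  right : ∀ i, i + 1 < n → i % 2 = t → b i = i + 1 ∨ b i = min (i + 2) (n - 1)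
  -- The mate of a point is the sum of the two indices of its block minus its own. At the ends,
  -- truncation and `min` make a single point its own mate, and the condition is then trivially
  -- true.
  left_wide : ∀ i, i + 1 < n → i % 2 = t → Wide (q (a i)) (q (i - 1 + i - a i)) (q (b i))
  right_wide : ∀ i, i + 1 < n → i % 2 = t →
    Wide (q (b i)) (q (i + 1 + min (i + 2) (n - 1) - b i)) (q (a i))
  narrow : ∀ i, i + 3 < n → i % 2 = t → b i = a (i + 2) →
    Narrow (q (b i)) (q (i + 1 + (i + 2) - b i)) (q (a i)) ∧
    Narrow (q (b i)) (q (i + 1 + (i + 2) - b i)) (q (b (i + 2)))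

/-- The graph on `n` vertices with the edges `{a k, b k}`, `k < n - 1`. -/
def listedGraph (n : ℕ) (a b : ℕ → ℕ) : SimpleGraph (Fin n) :=
  SimpleGraph.fromRel fun i j => ∃ k, k < n - 1 ∧ a k = i.1 ∧ b k = j.1

theorem listedGraph_adj {n : ℕ} {a b : ℕ → ℕ} {v w : Fin n} :
    (listedGraph n a b).Adj v w ↔ v ≠ w ∧
      ∃ k, k + 1 < n ∧ ((a k = v.1 ∧ b k = w.1) ∨ (a k = w.1 ∧ b k = v.1)) := by
  rw [listedGraph, SimpleGraph.fromRel_adj]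
  refine and_congr_right fun _ => ⟨?_, ?_⟩
  · rintro (⟨k, hk, h⟩ | ⟨k, hk, h⟩)
    · exact ⟨k, by omega, .inl h⟩
    · exact ⟨k, by omega, .inr h⟩
  · rintro ⟨k, hk, h | h⟩
    · exact .inl ⟨k, by omega, h⟩
    · exact .inr ⟨k, by omega, h⟩

namespace IsLinkage

variable {n t : ℕ} {q : ℕ → Plane} {a b : ℕ → ℕ}

theorem listed_lt (h : IsLinkage n t q a b) {k : ℕ} (hk : k + 1 < n) :
    a k < n ∧ b k < n ∧ a k < b k := by
  have := h.mate k hk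
  have := h.left k hk
  have := h.right k hk
  omega

/-- A point in the block that ends in `j` can meet only its mate, link `j` and link `j - 2`. The
axis of the cone points to the mate if both links are present, bisects the mate and the link if one
is, and points to the only neighbor otherwise. -/
theorem angleBounded (h : IsLinkage n t q a b)
    (hq : ∀ i j, i < n → j < n → q i = q j → i = j) :
    AngleBounded (2 * Real.pi / 3) (fun i : Fin n => q i) (listedGraph n a b) := by
  intro v
  have hpi : 2 * Real.pi / 3 / 2 = Real.pi / 3 := by ring
  rw [hpi]
  change ∃ d : Plane, d ≠ 0 ∧ ∀ w, (listedGraph n a b).Adj v w →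
    InnerProductGeometry.angle d (q w - q v) ≤ Real.pi / 3
  have ht := h.lt_two
  obtain ⟨j, hjt, hj⟩ : ∃ j, j % 2 = t ∧ (v.1 + 1 = j ∨ v.1 = j) := by
    by_cases hv : v.1 % 2 = t
    · exact ⟨v, hv, .inr rfl⟩
    · exact ⟨v + 1, by omega, .inl rfl⟩
  have hvn := v.2
  have nbr : ∀ w : Fin n, (listedGraph n a b).Adj v w → w ≠ v ∧
      ((0 < j ∧ j < n ∧ w.1 = j - 1 + j - v.1) ∨ (j + 1 < n ∧ a j = v.1 ∧ b j = w.1) ∨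
        (2 ≤ j ∧ b (j - 2) = v.1 ∧ a (j - 2) = w.1)) := by
    intro w hw
    obtain ⟨hne, k, hk, hkv⟩ := listedGraph_adj.1 hw
    refine ⟨hne.symm, ?_⟩
    have hwn := w.2
    have h₁ := h.mate k hk
    have h₂ := h.left k hk
    have h₃ := h.right k hk
    by_cases hkt : k % 2 = t
    · obtain rfl | rfl : k = j ∨ k + 2 = j := by omega
      · right; left; omega
      · right; right
        simp only [Nat.add_sub_cancel]
        omega
    · left; omega
  have qne : ∀ w : Fin n, w ≠ v → q w ≠ q v := fun w hw hqw =>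
    hw (Fin.ext (hq _ _ w.2 v.2 hqw))
  have single : (∀ w w' : Fin n, (listedGraph n a b).Adj v w → (listedGraph n a b).Adj v w' →
      w = w') → ∃ d : Plane, d ≠ 0 ∧ ∀ w, (listedGraph n a b).Adj v w →
        InnerProductGeometry.angle d (q w - q v) ≤ Real.pi / 3 := by
    intro hu
    by_cases hex : ∃ w, (listedGraph n a b).Adj v w
    · obtain ⟨w, hw⟩ := hex
      have hne := sub_ne_zero.2 (qne w (nbr w hw).1)
      refine ⟨q w - q v, hne, fun w' hw' => ?_⟩
      rw [hu w' w hw' hw, InnerProductGeometry.angle_self hne]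
      positivity
    · obtain ⟨d, hd⟩ := exists_ne (0 : Plane)
      exact ⟨d, hd, fun w hw => absurd ⟨w, hw⟩ hex⟩
  -- Otherwise the block is a single end point of the path, with at most one link.
  by_cases hj0 : 0 < j ∧ j < n
  swap
  · refine single fun w w' hw hw' => Fin.ext ?_
    have h₁ := (nbr w hw).2
    have h₂ := (nbr w' hw').2
    omega
  obtain ⟨hj0, hjn⟩ := hj0
  set m := j - 1 + j - v.1 with hm
  have hmv : q m ≠ q v := fun he => by
    have := hq m v (by omega) hvn he
    omega
  have qne' : ∀ w : ℕ, w < n → w ≠ v.1 → q w ≠ q v := fun w hw hne he => hne (hq _ _ hw hvn he)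
  by_cases hR : j + 1 < n ∧ a j = v.1
  · have hlR := h.listed_lt hR.1
    have hbv : q (b j) ≠ q v := qne' _ hlR.2.1 (by omega)
    by_cases hL : 2 ≤ j ∧ b (j - 2) = v.1
    · have hlL := h.listed_lt (k := j - 2) (by omega)
      have hav : q (a (j - 2)) ≠ q v := qne' _ hlL.1 (by omega)
      have hj2 : j - 2 + 2 = j := by omega
      have hmm : j - 2 + 1 + j - v.1 = m := by omega
      have key := h.narrow (j - 2) (by omega) (by omega) (by rw [hj2, hL.2, hR.2])
      rw [hj2, hL.2, hmm] at key
      refine ⟨q m - q v, sub_ne_zero.2 hmv, fun w hw => ?_⟩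
      obtain ⟨hwv, hw | hw | hw⟩ := nbr w hw
      · rw [hw.2.2, InnerProductGeometry.angle_self (sub_ne_zero.2 hmv)]
        positivity
      · rw [← hw.2.2]; exact key.2.angle_le hmv hbv
      · rw [← hw.2.2]; exact key.1.angle_le hmv hav
    · have key := h.left_wide j hR.1 hjt
      rw [hR.2] at key
      obtain ⟨d, hd, h₁, h₂⟩ := key.exists_cone hmv hbv
      refine ⟨d, hd, fun w hw => ?_⟩
      obtain ⟨hwv, hw | hw | hw⟩ := nbr w hw
      · rwa [hw.2.2]
      · rwa [← hw.2.2]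
      · exact absurd ⟨hw.1, hw.2.1⟩ hL
  · by_cases hL : 2 ≤ j ∧ b (j - 2) = v.1
    · have hlL := h.listed_lt (k := j - 2) (by omega)
      have hav : q (a (j - 2)) ≠ q v := qne' _ hlL.1 (by omega)
      have hj2 : j - 2 + 2 = j := by omega
      have hmm : j - 2 + 1 + min j (n - 1) - v.1 = m := by omega
      have key := h.right_wide (j - 2) (by omega) (by omega)
      rw [hj2, hL.2, hmm] at key
      obtain ⟨d, hd, h₁, h₂⟩ := key.exists_cone hmv hav
      refine ⟨d, hd, fun w hw => ?_⟩
      obtain ⟨hwv, hw | hw | hw⟩ := nbr w hw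
      · rwa [hw.2.2]
      · exact absurd ⟨hw.1, hw.2.1⟩ hR
      · rwa [← hw.2.2]
    · refine single fun w w' hw hw' => Fin.ext ?_
      have h₁ := (nbr w hw).2
      have h₂ := (nbr w' hw').2
      omega

/-- The walk is block edge, link, block edge, where a block edge is omitted if the link already ends
at the wanted point. -/
theorem exists_walk (h : IsLinkage n t q a b) {i : ℕ} (hi : i + 1 < n) :
    ∃ w : (listedGraph n a b).Walk ⟨i, by omega⟩ ⟨i + 1, hi⟩, w.length ≤ 3 := by
  by_cases hit : i % 2 = t
  swap
  · refine ⟨SimpleGraph.Walk.cons (listedGraph_adj.2 ⟨?_, i, hi, .inl ?_⟩) .nil, by simp⟩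
    · simp
    · exact h.mate i hi hit
  have h₁ := h.left i hi hit
  have h₂ := h.right i hi hit
  have ht := h.lt_two
  have hlt := h.listed_lt hi
  have link : (listedGraph n a b).Adj ⟨a i, hlt.1⟩ ⟨b i, hlt.2.1⟩ :=
    listedGraph_adj.2 ⟨by simp; omega, i, hi, .inl ⟨rfl, rfl⟩⟩
  obtain ⟨w₁, hw₁⟩ : ∃ w : (listedGraph n a b).Walk ⟨i, by omega⟩ ⟨a i, hlt.1⟩,
      w.length ≤ 1 := by
    by_cases hai : a i = i
    · exact ⟨SimpleGraph.Walk.nil.copy rfl (by simp [hai]), by simp⟩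
    · refine ⟨SimpleGraph.Walk.cons (listedGraph_adj.2 ⟨?_, i - 1, by omega, .inr ?_⟩) .nil,
        by simp⟩
      · simp; omega
      · have := h.mate (i - 1) (by omega) (by omega)
        simp only
        omega
  obtain ⟨w₂, hw₂⟩ : ∃ w : (listedGraph n a b).Walk ⟨b i, hlt.2.1⟩ ⟨i + 1, hi⟩,
      w.length ≤ 1 := by
    by_cases hbi : b i = i + 1
    · exact ⟨SimpleGraph.Walk.nil.copy rfl (by simp [hbi]), by simp⟩
    · refine ⟨SimpleGraph.Walk.cons (listedGraph_adj.2 ⟨?_, i + 1, by omega, .inr ?_⟩) .nil,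
        by simp⟩
      · simp; omega
      · have := h.mate (i + 1) (by omega) (by omega)
        simp only
        omega
  refine ⟨w₁.append (.cons link w₂), ?_⟩
  rw [SimpleGraph.Walk.length_append, SimpleGraph.Walk.length_cons]
  omega

theorem isHopSpannerOfPath (h : IsLinkage n t q a b) :
    IsHopSpannerOfPath 3 (listedGraph n a b) := by
  intro i j hij
  obtain ⟨w, hw⟩ : ∃ w : (listedGraph n a b).Walk i j, w.length ≤ 3 := by
    rw [SimpleGraph.pathGraph_adj] at hij
    rcases hij with hij | hij
    · obtain ⟨w, hw⟩ := h.exists_walk (i := i) (by omega)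
      exact ⟨w.copy rfl (Fin.ext hij), by simpa using hw⟩
    · obtain ⟨w, hw⟩ := h.exists_walk (i := j) (by omega)
      exact ⟨w.reverse.copy (Fin.ext hij) rfl, by simpa using hw⟩
  classical
  exact ⟨w.bypass, w.bypass_isPath, w.length_bypass_le_length.trans hw⟩

theorem connected (h : IsLinkage n t q a b) (hn : 1 ≤ n) : (listedGraph n a b).Connected := by
  have key : ∀ i (hi : i < n), (listedGraph n a b).Reachable ⟨0, hn⟩ ⟨i, hi⟩ := by
    intro i
    induction i with
    | zero => exact fun _ => .refl _
    | succ i ih =>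
      intro hi
      obtain ⟨w, -⟩ := h.exists_walk hi
      exact (ih (by omega)).trans ⟨w⟩
  have : Nonempty (Fin n) := ⟨⟨0, hn⟩⟩
  exact ⟨fun u v => (key u u.2).symm.trans (key v v.2)⟩

open Classical in
theorem edgeFinset_subset (h : IsLinkage n t q a b) :
    (listedGraph n a b).edgeFinset ⊆ Finset.univ.image fun k : Fin (n - 1) =>
      s((⟨a k, (h.listed_lt (by omega)).1⟩ : Fin n), ⟨b k, (h.listed_lt (by omega)).2.1⟩) := by
  intro e
  induction e using Sym2.ind with
  | _ v w =>
    intro he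
    rw [SimpleGraph.mem_edgeFinset, SimpleGraph.mem_edgeSet, listedGraph_adj] at he
    obtain ⟨-, k, hk, hkv⟩ := he
    refine Finset.mem_image.2 ⟨⟨k, by omega⟩, Finset.mem_univ _, ?_⟩
    rw [Sym2.eq_iff]
    rcases hkv with hkv | hkv
    · exact .inl ⟨Fin.ext hkv.1, Fin.ext hkv.2⟩
    · exact .inr ⟨Fin.ext hkv.1, Fin.ext hkv.2⟩

/-- Connectedness forces at least `n - 1` edges, and only `n - 1` are listed, so no separate proof
of acyclicity is needed. -/
theorem isTree (h : IsLinkage n t q a b) (hn : 1 ≤ n) : (listedGraph n a b).IsTree := by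
  classical
  have hc := h.connected hn
  rw [SimpleGraph.isTree_iff_connected_and_card]
  refine ⟨hc, ?_⟩
  have h₁ := hc.card_vert_le_card_edgeSet_add_one
  have h₂ := Finset.card_le_card h.edgeFinset_subset
  have h₃ := h₂.trans Finset.card_image_le
  rw [Finset.card_univ, Fintype.card_fin] at h₃
  rw [Nat.card_eq_fintype_card (α := (listedGraph n a b).edgeSet),
    ← SimpleGraph.edgeFinset_card] at h₁ ⊢
  rw [Nat.card_eq_fintype_card, Fintype.card_fin] at h₁ ⊢
  omega

theorem graphWeight_le (h : IsLinkage n t q a b) :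
    graphWeight (fun i : Fin n => q i) (listedGraph n a b) ≤
      ∑ k ∈ Finset.range (n - 1), dist (q (a k)) (q (b k)) := by
  classical
  rw [graphWeight]
  have nn : ∀ e : Sym2 (Fin n), 0 ≤ Sym2.lift ⟨fun i j : Fin n => dist (q i) (q j),
      fun _ _ => dist_comm _ _⟩ e := fun e => by
    induction e using Sym2.ind with
    | _ v w => exact dist_nonneg (x := q v) (y := q w)
  refine (Finset.sum_le_sum_of_subset_of_nonneg (by convert h.edgeFinset_subset)
    fun e _ _ => nn e).trans ?_
  refine (Finset.sum_image_le_of_nonneg fun e _ => nn e).trans ?_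
  rw [Finset.sum_range]
  rfl

end IsLinkage

end BoundedAngle

/-! ### The weight bound -/

namespace BoundedAngle

/-- If the heavier half of a sequence is charged once with itself and once with its neighbors, and
the other half is charged once with itself, the total charge is at most twice the sum. -/
theorem sum_le_two_mul_sum_of_alternate {f w : ℕ → ℝ} {N t : ℕ} (hf : ∀ k, 0 ≤ f k)
    (hN : ∀ k, N ≤ k → f k = 0)
    (hsplit : (∑ k ∈ Finset.range N, if k % 2 = t then 0 else f k) ≤
      ∑ k ∈ Finset.range N, if k % 2 = t then f k else 0)
    (hmate : ∀ k < N, k % 2 ≠ t → w k ≤ f k)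
    (hlink : ∀ k < N, k % 2 = t → w k ≤ (if k = 0 then 0 else f (k - 1)) + f k + f (k + 1)) :
    ∑ k ∈ Finset.range N, w k ≤ 2 * ∑ k ∈ Finset.range N, f k := by
  set m : ℕ → ℝ := fun k => if k % 2 = t then 0 else f k with hm
  have hm0 : ∀ k, 0 ≤ m k := fun k => by
    simp only [hm]
    split_ifs
    exacts [le_rfl, hf k]
  -- The neighbors of an index of parity `t` have the other parity, so `m` agrees with `f` there.
  -- Summing gives the sum of `f` plus twice that of `m`, and `m` carries at most half of `f`.
  have h₁ : ∀ k ∈ Finset.range N, w k ≤ f k + m (k + 1) + (if k = 0 then 0 else m (k - 1)) := by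
    intro k hk
    rw [Finset.mem_range] at hk
    by_cases hkt : k % 2 = t
    · refine (hlink k hk hkt).trans (le_of_eq ?_)
      have e₁ : m (k + 1) = f (k + 1) := if_neg (by omega)
      have e₂ : (if k = 0 then 0 else m (k - 1)) = if k = 0 then 0 else f (k - 1) := by
        split_ifs with hk0
        · rfl
        · exact if_neg (by omega)
      rw [e₁, e₂]
      ring
    · have := hmate k hk hkt
      have := hm0 (k + 1)
      have : 0 ≤ (if k = 0 then 0 else m (k - 1)) := by
        split_ifs
        exacts [le_rfl, hm0 _]
      linarith
  have h₂ : ∑ k ∈ Finset.range N, m (k + 1) ≤ ∑ k ∈ Finset.range N, m k := by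
    have e₁ := Finset.sum_range_succ m N
    have e₂ := Finset.sum_range_succ' m N
    have e₃ : m N = 0 := by simp [hm, hN]
    linarith [hm0 0]
  have h₃ : ∑ k ∈ Finset.range N, (if k = 0 then 0 else m (k - 1)) ≤
      ∑ k ∈ Finset.range N, m k := by
    cases N with
    | zero => simp
    | succ N =>
      rw [Finset.sum_range_succ', Finset.sum_range_succ]
      simpa using hm0 N
  have h₄ : ∑ k ∈ Finset.range N, f k = (∑ k ∈ Finset.range N, m k) +
      ∑ k ∈ Finset.range N, if k % 2 = t then f k else 0 := by
    rw [← Finset.sum_add_distrib]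
    refine Finset.sum_congr rfl fun k _ => ?_
    simp only [hm]
    split_ifs <;> ring
  have h₅ := Finset.sum_le_sum h₁
  rw [Finset.sum_add_distrib, Finset.sum_add_distrib] at h₅
  linarith

/-- The sign of an alternating sum tells which half of the terms has the larger sum. -/
theorem sum_alternate_le {f : ℕ → ℝ} {N t : ℕ}
    (ht : t = if 0 ≤ ∑ k ∈ Finset.range N, (-1) ^ k * f k then 0 else 1) :
    (∑ k ∈ Finset.range N, if k % 2 = t then 0 else f k) ≤
      ∑ k ∈ Finset.range N, if k % 2 = t then f k else 0 := by
  have key : ∀ k ∈ Finset.range N, (-1) ^ k * f k =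
      (if k % 2 = 0 then f k else 0) - (if k % 2 = 0 then 0 else f k) := by
    intro k _
    rcases Nat.even_or_odd k with h | h
    · simp [h.neg_one_pow, Nat.even_iff.1 h]
    · simp [h.neg_one_pow, Nat.odd_iff.1 h]
  rw [Finset.sum_congr rfl key, Finset.sum_sub_distrib] at ht
  split_ifs at ht with h
  · subst ht
    linarith
  · subst ht
    have e₁ : ∀ k : ℕ, (if k % 2 = 1 then (0 : ℝ) else f k) = if k % 2 = 0 then f k else 0 :=
      fun k => by rcases Nat.mod_two_eq_zero_or_one k with h | h <;> simp [h]
    have e₂ : ∀ k : ℕ, (if k % 2 = 1 then f k else (0 : ℝ)) = if k % 2 = 0 then 0 else f k :=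
      fun k => by rcases Nat.mod_two_eq_zero_or_one k with h | h <;> simp [h]
    simp only [e₁, e₂]
    linarith

namespace IsLinkage

variable {n t : ℕ} {q : ℕ → Plane} {a b : ℕ → ℕ}

/-- The triangle inequality through the end points of the replaced path edge provides the charges of
`sum_le_two_mul_sum_of_alternate`. The sequence `f` is cut off to `0` from `n - 1` on, so a missing
last block edge costs nothing. -/
theorem graphWeight_le_two_mul (h : IsLinkage n t q a b)
    (ht : t = if 0 ≤ ∑ k ∈ Finset.range (n - 1), (-1) ^ k * dist (q k) (q (k + 1)) then 0 else 1) :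
    graphWeight (fun i : Fin n => q i) (listedGraph n a b) ≤
      2 * pathWeight (fun i : Fin n => q i) := by
  set f : ℕ → ℝ := fun k => if k < n - 1 then dist (q k) (q (k + 1)) else 0 with hf
  have hfk : ∀ k, k < n - 1 → f k = dist (q k) (q (k + 1)) := fun k hk => if_pos hk
  have hpath : pathWeight (fun i : Fin n => q i) = ∑ k ∈ Finset.range (n - 1), f k := by
    rw [pathWeight, Finset.sum_range]
    exact Finset.sum_congr rfl fun k _ => (hfk k k.2).symm
  rw [hpath]
  refine h.graphWeight_le.trans (sum_le_two_mul_sum_of_alternate (t := t) ?_ ?_ ?_ ?_ ?_)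
  · intro k
    simp only [hf]
    split_ifs
    exacts [dist_nonneg, le_rfl]
  · exact fun k hk => if_neg (by omega)
  · refine sum_alternate_le (ht.trans ?_)
    rw [Finset.sum_congr rfl fun k hk =>
      congrArg (fun x : ℝ => (-1) ^ k * x) (hfk k (Finset.mem_range.1 hk)).symm]
  · intro k hk hkt
    rw [(h.mate k (by omega) hkt).1, (h.mate k (by omega) hkt).2, hfk k hk]
  · intro k hk hkt
    have h₁ : dist (q (a k)) (q k) ≤ if k = 0 then 0 else f (k - 1) := by
      rcases h.left k (by omega) hkt with e | e <;> rw [e] <;> split_ifs with hk0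
      · simp [hk0]
      · rw [hfk (k - 1) (by omega), Nat.sub_add_cancel (by omega)]
      · simp
      · simpa [hf] using by positivity
    have h₂ : dist (q (k + 1)) (q (b k)) ≤ f (k + 1) := by
      have h0 : 0 ≤ f (k + 1) := by
        simp only [hf]
        split_ifs
        exacts [dist_nonneg, le_rfl]
      by_cases e : b k = k + 1
      · rw [e, dist_self]
        exact h0
      · have e' := h.right k (by omega) hkt
        have : b k = k + 1 + 1 ∧ k + 1 < n - 1 := by omega
        rw [this.1, hfk _ this.2]
    rw [hfk k hk]
    linarith [dist_triangle4 (q (a k)) (q k) (q (k + 1)) (q (b k))]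

end IsLinkage

end BoundedAngle

/-! ### From local link choices to a linkage -/

namespace BoundedAngle

/-- The two ways in which the block `{u, v}` may be linked to the preceding block `{a, b}`: by the
edge `{p, u}`, and, if a later edge occupies `u`, by the edge `{r, g}`. -/
structure LinkChoice (q : ℕ → Plane) (a b u v p g r : ℕ) : Prop where
  fits : Fits q a b p u
  wide : Wide (q u) (q v) (q p)
  fits_alt : Fits q a b r g
  alt : (g = u ∧ Narrow (q u) (q v) (q r)) ∨ (g = v ∧ Wide (q v) (q u) (q r))

/-- The points `j - 1` and `j`, as far as they exist, are `u` and `v`. -/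
def IsBlock (n j u v : ℕ) : Prop :=
  (u = j - 1 ∧ v = min j (n - 1)) ∨ (u = min j (n - 1) ∧ v = j - 1)

/-- The edge `{a j, b j}` joins the block `{U j, V j}` to the block `{U (j + 2), V (j + 2)}`, and is
compatible with edge `j + 2`. -/
structure IsLink (n : ℕ) (q : ℕ → Plane) (U V a b : ℕ → ℕ) (j : ℕ) : Prop where
  fits : Fits q (U j) (V j) (a j) (b j)
  wide : (b j = U (j + 2) ∧ Wide (q (U (j + 2))) (q (V (j + 2))) (q (a j))) ∨
    (b j = V (j + 2) ∧ Wide (q (V (j + 2))) (q (U (j + 2))) (q (a j)))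
  narrow : j + 3 < n → b j = a (j + 2) → b j = U (j + 2) ∧
    Narrow (q (U (j + 2))) (q (V (j + 2))) (q (a j)) ∧
    Narrow (q (U (j + 2))) (q (V (j + 2))) (q (b (j + 2)))

/-- Here `e` is the point of the block that the next link occupies. If it is the second point, the
edge to the first avoids it. If it is the first, the alternative edge either goes to the second
point or is narrow at the first, where `Fits` makes the next link narrow too. -/
theorem LinkChoice.isLink {n j : ℕ} {q : ℕ → Plane} {U V P G R a b : ℕ → ℕ}
    (h : LinkChoice q (U j) (V j) (U (j + 2)) (V (j + 2)) (P (j + 2)) (G (j + 2)) (R (j + 2)))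
    (hblock : IsBlock n (j + 2) (U (j + 2)) (V (j + 2))) {e : ℕ}
    (he : e = U (j + 2) ∨ e = V (j + 2))
    (hea : j + 3 < n → a (j + 2) = e)
    (hfits : j + 3 < n → Fits q (U (j + 2)) (V (j + 2)) (a (j + 2)) (b (j + 2)))
    (hj : (e = V (j + 2) ∧ b j = U (j + 2) ∧ a j = P (j + 2)) ∨
      (e ≠ V (j + 2) ∧ b j = G (j + 2) ∧ a j = R (j + 2))) :
    IsLink n q U V a b j := by
  -- Only a single-point block has equal entries, and no link follows such a final block.
  have hne : j + 3 < n → U (j + 2) ≠ V (j + 2) := fun hn => by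
    unfold IsBlock at hblock
    omega
  rcases hj with ⟨hev, hb, ha⟩ | ⟨hev, hb, ha⟩
  · refine ⟨?_, .inl ⟨hb, ?_⟩, fun hn hba => ?_⟩
    · rw [ha, hb]; exact h.fits
    · rw [ha]; exact h.wide
    · exact absurd (hb.symm.trans (hba.trans ((hea hn).trans hev))) (hne hn)
  · have heu := he.resolve_right hev
    refine ⟨?_, ?_, fun hn hba => ?_⟩
    · rw [ha, hb]; exact h.fits_alt
    · rw [ha, hb]
      exact h.alt.imp (fun h' => ⟨h'.1, h'.2.wide⟩) id
    · have hbu : b j = U (j + 2) := hba.trans ((hea hn).trans heu)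
      have hau : a (j + 2) = U (j + 2) := (hea hn).trans heu
      refine ⟨hbu, ?_, ?_⟩
      · rcases h.alt with h' | h'
        · rw [ha]; exact h'.2
        · exact absurd (hbu.symm.trans (hb.trans h'.1)) (hne hn)
      · rcases hfits hn with h' | h'
        · exact h'.2
        · exact absurd (hau.symm.trans h'.1) (hne hn)

theorem isLinkage_of_isLink {n t : ℕ} {q : ℕ → Plane} {U V a b : ℕ → ℕ} (ht : t < 2)
    (hmate : ∀ i, i + 1 < n → i % 2 ≠ t → a i = i ∧ b i = i + 1)
    (hblock : ∀ j, j ≤ n → j % 2 = t → IsBlock n j (U j) (V j))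
    (hlink : ∀ j, j + 1 < n → j % 2 = t → IsLink n q U V a b j) :
    IsLinkage n t q a b := by
  have sum : ∀ {j u v : ℕ}, IsBlock n j u v → u + v = j - 1 + min j (n - 1) := by
    intro j u v h
    unfold IsBlock at h
    omega
  have other : ∀ {j : ℕ}, j ≤ n → j % 2 = t → ∀ x,
      (x = U j → j - 1 + min j (n - 1) - x = V j) ∧
      (x = V j → j - 1 + min j (n - 1) - x = U j) := fun hj hjt x => by
    have := sum (hblock _ hj hjt)
    omega
  have hmin : ∀ {j : ℕ}, j + 1 < n → min j (n - 1) = j := fun hj => by omega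
  refine ⟨ht, hmate, fun i hi hit => ?_, fun i hi hit => ?_, fun i hi hit => ?_,
    fun i hi hit => ?_, fun i hi hit hba => ?_⟩
  · have h₁ := hblock i (by omega) hit
    unfold IsBlock at h₁
    rcases (hlink i hi hit).fits with h | h <;> omega
  · have h₁ := hblock (i + 2) (by omega) (by omega)
    unfold IsBlock at h₁
    rcases (hlink i hi hit).wide with h | h <;> omega
  · have ho := other (j := i) (by omega) hit (a i)
    rw [hmin hi] at ho
    rcases (hlink i hi hit).fits with h | h
    · rw [ho.1 h.1, h.1]; exact h.2.wide
    · rw [ho.2 h.1, h.1]; exact h.2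
  · have ho := other (j := i + 2) (by omega) (by omega) (b i)
    rw [show i + 2 - 1 = i + 1 by omega] at ho
    rcases (hlink i hi hit).wide with h | h
    · rw [ho.1 h.1, h.1]; exact h.2
    · rw [ho.2 h.1, h.1]; exact h.2
  · have ho := other (j := i + 2) (by omega) (by omega) (b i)
    rw [show i + 2 - 1 = i + 1 by omega, hmin (by omega)] at ho
    have h := (hlink i (by omega) hit).narrow hi hba
    rw [ho.1 h.1, h.1]
    exact h.2

end BoundedAngle

/-! ### Running time of loop-free programs and of loops -/

namespace RealRAM

open scoped RealInnerProductSpace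
open BoundedAngle

namespace Program

/-- The program contains no loop. -/
def LoopFree : Program → Prop
  | skip | setNat _ _ _ | setReal _ _ _ => True
  | seq P Q | cond _ P Q => P.LoopFree ∧ Q.LoopFree
  | loop _ _ => False

open Classical in
/-- The final state of a loop-free program. -/
noncomputable def exec : Program → State → State
  | skip, s | loop _ _, s => s
  | setNat a i e, s => s.writeNat a (i.eval s) (e.eval s)
  | setReal a i e, s => s.writeReal a (i.eval s) (e.eval s)
  | seq P Q, s => Q.exec (P.exec s)
  | cond b P Q, s => if b.Holds s then P.exec s else Q.exec s

/-- An upper bound for the number of steps of a loop-free program. -/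
def bound : Program → ℕ
  | skip | loop _ _ => 1
  | setNat _ i e => i.cost + e.cost + 1
  | setReal _ i e => i.cost + e.cost + 1
  | seq P Q => P.bound + Q.bound
  | cond b P Q => b.cost + (P.bound + Q.bound) + 1

theorem LoopFree.runs {P : Program} (h : P.LoopFree) (s : State) :
    ∃ t, Runs P s (P.exec s) t ∧ t ≤ P.bound := by
  induction P generalizing s with
  | skip => exact ⟨1, .skip s, le_rfl⟩
  | setNat a i e => exact ⟨_, .setNat a i e s, le_rfl⟩
  | setReal a i e => exact ⟨_, .setReal a i e s, le_rfl⟩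
  | seq P Q ihP ihQ =>
    obtain ⟨t₁, h₁, h₁'⟩ := ihP h.1 s
    obtain ⟨t₂, h₂, h₂'⟩ := ihQ h.2 (P.exec s)
    exact ⟨_, .seq h₁ h₂, Nat.add_le_add h₁' h₂'⟩
  | cond b P Q ihP ihQ =>
    by_cases hb : b.Holds s
    · obtain ⟨t, h₁, h₁'⟩ := ihP h.1 s
      rw [exec, if_pos hb, bound]
      exact ⟨_, .condTrue Q hb h₁, by omega⟩
    · obtain ⟨t, h₁, h₁'⟩ := ihQ h.2 s
      rw [exec, if_neg hb, bound]
      exact ⟨_, .condFalse P hb h₁, by omega⟩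
  | loop => exact h.elim

/-- A loop with a loop-free body halts if the body decreases a counter while it preserves an
invariant. -/
theorem LoopFree.runs_loop {P : Program} (h : P.LoopFree) (b : Test) (I : ℕ → State → Prop)
    (hstep : ∀ k s, I k s → b.Holds s → ∃ k' < k, I k' (P.exec s)) :
    ∀ k s, I k s → ∃ s' t k', Runs (loop b P) s s' t ∧ t ≤ (k + 1) * (b.cost + P.bound + 1) ∧
      ¬ b.Holds s' ∧ I k' s' := by
  intro k
  induction k using Nat.strong_induction_on with
  | _ k ih =>
    intro s hs
    by_cases hb : b.Holds s
    · obtain ⟨k₁, hk₁, h₁⟩ := hstep k s hs hb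
      obtain ⟨t₁, hr₁, ht₁⟩ := h.runs s
      obtain ⟨s', t₂, k', hr₂, ht₂, hs'⟩ := ih k₁ hk₁ _ h₁
      refine ⟨s', _, k', .loopStep hb hr₁ hr₂, ?_, hs'⟩
      have := Nat.mul_le_mul_right (b.cost + P.bound + 1) (Nat.succ_le_of_lt hk₁)
      rw [add_one_mul]
      rw [Nat.succ_eq_add_one] at this
      omega
    · refine ⟨s, _, k, .loopDone P hb, ?_, hb, hs⟩
      rw [add_one_mul]
      omega

end Program

/-! ### The program and the effect of its steps -/

/-- The content of cell `c` of array `0` of natural numbers. -/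
def cell (c : ℕ) : NatExpr := .read 0 (.const c)

/-- The distance between two points, given by their numbers. -/
def distExpr (x y : NatExpr) : RealExpr :=
  .sqrt (.add
    (.mul (.sub (.read 0 x) (.read 0 y)) (.sub (.read 0 x) (.read 0 y)))
    (.mul (.sub (.read 1 x) (.read 1 y)) (.sub (.read 1 x) (.read 1 y))))

/-- The inner product of the vectors from the point `o` to the points `m` and `z`. -/
def innerExpr (o m z : NatExpr) : RealExpr :=
  .add (.mul (.sub (.read 0 m) (.read 0 o)) (.sub (.read 0 z) (.read 0 o)))
    (.mul (.sub (.read 1 m) (.read 1 o)) (.sub (.read 1 z) (.read 1 o)))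

/-- The test `Narrow` for the points whose numbers are in the given cells. -/
def narrowTest (o m z : ℕ) : Test :=
  .realLe (.mul (distExpr (cell m) (cell o)) (distExpr (cell z) (cell o)))
    (.mul (.const 2) (innerExpr (cell o) (cell m) (cell z)))

/-- The test `Wide` for the points whose numbers are in the given cells. -/
def wideTest (o m z : ℕ) : Test :=
  .realLe (.const 0) (.add (.mul (.const 2) (innerExpr (cell o) (cell m) (cell z)))
    (.mul (distExpr (cell m) (cell o)) (distExpr (cell z) (cell o))))

/-- The coordinates of the points are in the arrays `0` and `1` of real numbers. -/
def State.Stores (s : State) (q : ℕ → Plane) : Prop :=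
  ∀ i, s.real 0 i = q i 0 ∧ s.real 1 i = q i 1

variable {s : State} {q : ℕ → Plane}

theorem State.Stores.eval_distExpr (hs : s.Stores q) (x y : NatExpr) :
    (distExpr x y).eval s = dist (q (x.eval s)) (q (y.eval s)) := by
  simp only [distExpr, RealExpr.eval, (hs _).1, (hs _).2]
  rw [EuclideanSpace.dist_eq, Fin.sum_univ_two, Real.dist_eq, Real.dist_eq, sq_abs, sq_abs, sq, sq]

theorem State.Stores.eval_innerExpr (hs : s.Stores q) (o m z : NatExpr) :
    (innerExpr o m z).eval s =
      ⟪q (m.eval s) - q (o.eval s), q (z.eval s) - q (o.eval s)⟫ := by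
  simp only [innerExpr, RealExpr.eval, (hs _).1, (hs _).2]
  rw [PiLp.inner_apply, Fin.sum_univ_two]
  simp
  ring

theorem State.Stores.holds_narrowTest (hs : s.Stores q) (o m z : ℕ) :
    (narrowTest o m z).Holds s ↔ Narrow (q (s.nat 0 o)) (q (s.nat 0 m)) (q (s.nat 0 z)) := by
  simp [narrowTest, Test.Holds, RealExpr.eval, hs.eval_distExpr, hs.eval_innerExpr, Narrow, cell,
    NatExpr.eval]

theorem State.Stores.holds_wideTest (hs : s.Stores q) (o m z : ℕ) :
    (wideTest o m z).Holds s ↔ Wide (q (s.nat 0 o)) (q (s.nat 0 m)) (q (s.nat 0 z)) := by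
  simp [wideTest, Test.Holds, RealExpr.eval, hs.eval_distExpr, hs.eval_innerExpr, Wide, cell,
    NatExpr.eval]

open Program

/-- Cell `1` of array `0` holds the running index `i`. -/
def idx : NatExpr := cell 1

/-- List the path edge that precedes the point `i`, and update the alternating sum of the lengths. -/
def listMate : Program :=
  .seq (.setNat 0 (.const 1) (.sub idx (.const 1)))
    (.seq (.setNat 1 idx idx)
      (.seq (.setNat 2 idx (.add idx (.const 1)))
        (.setReal 2 (.const 0)
          (.sub (distExpr idx (.add idx (.const 1))) (.read 2 (.const 0))))))

/-- Store the block in the cells `u`, `v` and its links to the block before. -/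
def storeBlock (u v p g r : ℕ) : Program :=
  .seq (.setNat 3 (.add idx (.const 2)) (cell u))
    (.seq (.setNat 4 (.add idx (.const 2)) (cell v))
      (.seq (.setNat 5 (.add idx (.const 2)) (cell p))
        (.seq (.setNat 6 (.add idx (.const 2)) (cell g))
          (.setNat 7 (.add idx (.const 2)) (cell r)))))

/-- Choose the links between the block in the cells `3`, `4` and the block in the cells `5`, `6`. -/
def chooseLink : Program :=
  .cond (.and (narrowTest 3 4 5) (narrowTest 5 6 3)) (storeBlock 5 6 3 5 3)
    (.cond (.and (wideTest 4 3 5) (narrowTest 5 6 4)) (storeBlock 5 6 4 5 4)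
      (.cond (.and (narrowTest 3 4 6) (narrowTest 6 5 3)) (storeBlock 6 5 3 6 3)
        (.cond (.and (wideTest 4 3 6) (narrowTest 6 5 4)) (storeBlock 6 5 4 6 4)
          (.cond (.and (narrowTest 3 4 5) (wideTest 5 6 3))
            (.cond (.and (narrowTest 3 4 6) (wideTest 6 5 3))
              (storeBlock 5 6 3 6 3) (storeBlock 5 6 3 6 4))
            (.cond (.and (narrowTest 3 4 6) (wideTest 6 5 3))
              (storeBlock 5 6 4 6 3) (storeBlock 5 6 4 6 4))))))

/-- Copy the numbers of the points of the blocks before and after the edge `{i, i + 1}` into the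
cells `3`, `4` and `5`, `6`. -/
def loadBlocks : Program :=
  .seq (.setNat 0 (.const 3) (.read 3 idx))
    (.seq (.setNat 0 (.const 4) (.read 4 idx))
      (.seq (.setNat 0 (.const 5) (.add idx (.const 1)))
        (.setNat 0 (.const 6) (.sub (.add idx (.const 2))
          (.sub (.add idx (.const 2)) (.sub (cell 0) (.const 1)))))))

/-- Link the block that ends in `i` to the next block, and advance to that block. -/
def forwardStep : Program :=
  .seq loadBlocks (.seq chooseLink (.setNat 0 (.const 1) (.add idx (.const 2))))

/-- List the link before the block that ends in `i`; cell `2` holds the point of this block that is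
used by the link after it. -/
def backwardStep : Program :=
  .seq
    (.cond (.and (.natLe (cell 2) (.read 4 idx)) (.natLe (.read 4 idx) (cell 2)))
      (.seq (.setNat 1 (.sub idx (.const 2)) (.read 5 idx))
        (.setNat 2 (.sub idx (.const 2)) (.read 3 idx)))
      (.seq (.setNat 1 (.sub idx (.const 2)) (.read 7 idx))
        (.setNat 2 (.sub idx (.const 2)) (.read 6 idx))))
    (.seq (.setNat 0 (.const 1) (.sub idx (.const 2)))
      (.setNat 0 (.const 2) (.read 1 idx)))

/-- Let the links be the heavier half of the path edges, and store the first block. -/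
def initialBlock : Program :=
  .seq (.cond (.realLe (.const 0) (.read 2 (.const 0))) .skip (.setNat 0 (.const 1) (.const 1)))
    (.seq (.setNat 3 idx (.sub idx (.const 1))) (.setNat 4 idx idx))

/-- The algorithm: list the path edges, choose the links from left to right, and list them from right
to left. -/
def spanningTree : Program :=
  .seq (.setNat 0 (.const 1) (.sub (cell 0) (.const 1)))
    (.seq (.loop (.natLe (.const 1) idx) listMate)
      (.seq initialBlock
        (.seq (.loop (.natLe (.add idx (.const 2)) (cell 0)) forwardStep)
          (.seq (.setNat 0 (.const 2) (.read 4 idx))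
            (.loop (.natLe (.const 2) idx) backwardStep)))))

theorem Program.exec_cond (b : Test) (P Q : Program) (s : State) :
    (b.Holds s ∧ (Program.cond b P Q).exec s = P.exec s) ∨
      (¬ b.Holds s ∧ (Program.cond b P Q).exec s = Q.exec s) := by
  by_cases hb : b.Holds s
  · exact .inl ⟨hb, if_pos hb⟩
  · exact .inr ⟨hb, if_neg hb⟩

theorem Test.holds_and {b₁ b₂ : Test} {s : State} :
    (Test.and b₁ b₂).Holds s ↔ b₁.Holds s ∧ b₂.Holds s := Iff.rfl

/-- The branches follow the alternatives of `exists_link`. A link narrow at its new end serves as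
both options of the `LinkChoice`; otherwise the two options end at different points. -/
theorem exec_chooseLink (hs : s.Stores q) : ∃ u v p g r : ℕ,
    chooseLink.exec s = (storeBlock u v p g r).exec s ∧
    ((u = 5 ∧ v = 6) ∨ (u = 6 ∧ v = 5)) ∧
    LinkChoice q (s.nat 0 3) (s.nat 0 4) (s.nat 0 u) (s.nat 0 v) (s.nat 0 p) (s.nat 0 g)
      (s.nat 0 r) := by
  have key := exists_link (q (s.nat 0 3)) (q (s.nat 0 4)) (q (s.nat 0 5)) (q (s.nat 0 6))
  have cases : ∀ b P Q, (b.Holds s ∧ (Program.cond b P Q).exec s = P.exec s) ∨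
      (¬ b.Holds s ∧ (Program.cond b P Q).exec s = Q.exec s) := fun b P Q =>
    Program.exec_cond b P Q s
  rw [chooseLink]
  rcases cases (.and (narrowTest 3 4 5) (narrowTest 5 6 3)) _ _ with ⟨h₁, e⟩ | ⟨h₁, e⟩ <;>
    rw [e] <;> clear e <;>
    rw [Test.holds_and, hs.holds_narrowTest, hs.holds_narrowTest] at h₁
  · exact ⟨5, 6, 3, 5, 3, rfl, .inl ⟨rfl, rfl⟩, .inl ⟨rfl, h₁.1⟩, h₁.2.wide, .inl ⟨rfl, h₁.1⟩,
      .inl ⟨rfl, h₁.2⟩⟩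
  rcases cases (.and (wideTest 4 3 5) (narrowTest 5 6 4)) _ _ with ⟨h₂, e⟩ | ⟨h₂, e⟩ <;>
    rw [e] <;> clear e <;>
    rw [Test.holds_and, hs.holds_wideTest, hs.holds_narrowTest] at h₂
  · exact ⟨5, 6, 4, 5, 4, rfl, .inl ⟨rfl, rfl⟩, .inr ⟨rfl, h₂.1⟩, h₂.2.wide, .inr ⟨rfl, h₂.1⟩,
      .inl ⟨rfl, h₂.2⟩⟩
  rcases cases (.and (narrowTest 3 4 6) (narrowTest 6 5 3)) _ _ with ⟨h₃, e⟩ | ⟨h₃, e⟩ <;>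
    rw [e] <;> clear e <;>
    rw [Test.holds_and, hs.holds_narrowTest, hs.holds_narrowTest] at h₃
  · exact ⟨6, 5, 3, 6, 3, rfl, .inr ⟨rfl, rfl⟩, .inl ⟨rfl, h₃.1⟩, h₃.2.wide, .inl ⟨rfl, h₃.1⟩,
      .inl ⟨rfl, h₃.2⟩⟩
  rcases cases (.and (wideTest 4 3 6) (narrowTest 6 5 4)) _ _ with ⟨h₄, e⟩ | ⟨h₄, e⟩ <;>
    rw [e] <;> clear e <;>
    rw [Test.holds_and, hs.holds_wideTest, hs.holds_narrowTest] at h₄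
  · exact ⟨6, 5, 4, 6, 4, rfl, .inr ⟨rfl, rfl⟩, .inr ⟨rfl, h₄.1⟩, h₄.2.wide, .inr ⟨rfl, h₄.1⟩,
      .inl ⟨rfl, h₄.2⟩⟩
  -- No narrow link exists, so both new points have wide ones; the remaining tests only find their
  -- old ends.
  obtain ⟨hc, hd⟩ := (key.resolve_left (not_or.2 ⟨h₁, h₂⟩)).resolve_left (not_or.2 ⟨h₃, h₄⟩)
  rcases cases (.and (narrowTest 3 4 5) (wideTest 5 6 3)) _ _ with ⟨h₅, e⟩ | ⟨h₅, e⟩ <;>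
    rw [e] <;> clear e <;>
    rw [Test.holds_and, hs.holds_narrowTest, hs.holds_wideTest] at h₅ <;>
    rcases cases (.and (narrowTest 3 4 6) (wideTest 6 5 3)) _ _ with ⟨h₆, e⟩ | ⟨h₆, e⟩ <;>
    rw [e] <;> clear e <;>
    rw [Test.holds_and, hs.holds_narrowTest, hs.holds_wideTest] at h₆
  · exact ⟨5, 6, 3, 6, 3, rfl, .inl ⟨rfl, rfl⟩, .inl ⟨rfl, h₅.1⟩, h₅.2, .inl ⟨rfl, h₆.1⟩,
      .inr ⟨rfl, h₆.2⟩⟩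
  · have hd' := hd.resolve_left h₆
    exact ⟨5, 6, 3, 6, 4, rfl, .inl ⟨rfl, rfl⟩, .inl ⟨rfl, h₅.1⟩, h₅.2, .inr ⟨rfl, hd'.1⟩,
      .inr ⟨rfl, hd'.2⟩⟩
  · have hc' := hc.resolve_left h₅
    exact ⟨5, 6, 4, 6, 3, rfl, .inl ⟨rfl, rfl⟩, .inr ⟨rfl, hc'.1⟩, hc'.2, .inl ⟨rfl, h₆.1⟩,
      .inr ⟨rfl, h₆.2⟩⟩
  · have hc' := hc.resolve_left h₅
    have hd' := hd.resolve_left h₆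
    exact ⟨5, 6, 4, 6, 4, rfl, .inl ⟨rfl, rfl⟩, .inr ⟨rfl, hc'.1⟩, hc'.2, .inr ⟨rfl, hd'.1⟩,
      .inr ⟨rfl, hd'.2⟩⟩

theorem exec_storeBlock_nat (u v p g r : ℕ) (c j : ℕ) :
    ((storeBlock u v p g r).exec s).nat c j =
      if c = 7 ∧ j = s.nat 0 1 + 2 then s.nat 0 r else
      if c = 6 ∧ j = s.nat 0 1 + 2 then s.nat 0 g else
      if c = 5 ∧ j = s.nat 0 1 + 2 then s.nat 0 p else
      if c = 4 ∧ j = s.nat 0 1 + 2 then s.nat 0 v else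
      if c = 3 ∧ j = s.nat 0 1 + 2 then s.nat 0 u else s.nat c j := by
  simp [storeBlock, exec, State.writeNat, NatExpr.eval, idx, cell]
  rfl

/-- The effect of `forwardStep`. -/
theorem exec_forwardStep (hs : s.Stores q) {n i : ℕ} (hn : s.nat 0 0 = n) (hi : s.nat 0 1 = i) :
    ∃ u v p g r : ℕ,
      ((u = i + 1 ∧ v = min (i + 2) (n - 1)) ∨ (u = min (i + 2) (n - 1) ∧ v = i + 1)) ∧
      LinkChoice q (s.nat 3 i) (s.nat 4 i) u v p g r ∧
      (forwardStep.exec s).real = s.real ∧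
      (forwardStep.exec s).nat 0 0 = n ∧ (forwardStep.exec s).nat 0 1 = i + 2 ∧
      (∀ c, c = 1 ∨ c = 2 → (forwardStep.exec s).nat c = s.nat c) ∧
      (forwardStep.exec s).nat 3 = Function.update (s.nat 3) (i + 2) u ∧
      (forwardStep.exec s).nat 4 = Function.update (s.nat 4) (i + 2) v ∧
      (forwardStep.exec s).nat 5 = Function.update (s.nat 5) (i + 2) p ∧
      (forwardStep.exec s).nat 6 = Function.update (s.nat 6) (i + 2) g ∧
      (forwardStep.exec s).nat 7 = Function.update (s.nat 7) (i + 2) r := by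
  set s₁ := loadBlocks.exec s with hs₁
  have hnat : ∀ c j, s₁.nat c j =
      if c = 0 ∧ j = 6 then i + 2 - (i + 2 - (n - 1)) else if c = 0 ∧ j = 5 then i + 1 else
      if c = 0 ∧ j = 4 then s.nat 4 i else if c = 0 ∧ j = 3 then s.nat 3 i else s.nat c j := by
    intro c j
    simp [hs₁, loadBlocks, exec, State.writeNat, NatExpr.eval, idx, cell, hn, hi]
  -- Truncated subtraction computes the minimum, so a final single point is stored as both entries
  -- of its block.
  have hmin : i + 2 - (i + 2 - (n - 1)) = min (i + 2) (n - 1) := by omega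
  -- `loadBlocks` writes no real cells, so `hs` holds for `s₁` by definition.
  obtain ⟨u, v, p, g, r, he, huv, hL⟩ := exec_chooseLink (s := s₁) (q := q) hs
  have h3 : s₁.nat 0 3 = s.nat 3 i := by simp [hnat]
  have h4 : s₁.nat 0 4 = s.nat 4 i := by simp [hnat]
  have h5 : s₁.nat 0 5 = i + 1 := by simp [hnat]
  have h6 : s₁.nat 0 6 = min (i + 2) (n - 1) := by rw [← hmin]; simp [hnat]
  have h1 : s₁.nat 0 1 = i := by simp [hnat, hi]
  rw [h3, h4] at hL
  have hstep : forwardStep.exec s =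
      ((storeBlock u v p g r).exec s₁).writeNat 0 1
        (((storeBlock u v p g r).exec s₁).nat 0 1 + 2) := by
    rw [← he]; rfl
  refine ⟨_, _, _, _, _, ?_, hL, ?_⟩
  · rcases huv with ⟨rfl, rfl⟩ | ⟨rfl, rfl⟩ <;> simp [h5, h6]
  · rw [hstep]
    refine ⟨rfl, ?_, ?_, ?_, ?_, ?_, ?_, ?_, ?_⟩
    · simp [State.writeNat, exec_storeBlock_nat, hnat, hn]
    · simp [State.writeNat, exec_storeBlock_nat, h1]
    · rintro c (rfl | rfl) <;> ext j <;> simp [State.writeNat, exec_storeBlock_nat, hnat]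
    all_goals
      ext j
      simp [State.writeNat, exec_storeBlock_nat, h1, Function.update_apply, hnat]

/-- The effect of `backwardStep`. -/
theorem exec_backwardStep {i : ℕ} (hi : s.nat 0 1 = i) :
    ∃ x y : ℕ,
      ((s.nat 0 2 = s.nat 4 i ∧ y = s.nat 3 i ∧ x = s.nat 5 i) ∨
        (s.nat 0 2 ≠ s.nat 4 i ∧ y = s.nat 6 i ∧ x = s.nat 7 i)) ∧
      (backwardStep.exec s).nat 0 0 = s.nat 0 0 ∧ (backwardStep.exec s).nat 0 1 = i - 2 ∧
      (backwardStep.exec s).nat 0 2 = x ∧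
      (∀ c, 3 ≤ c → (backwardStep.exec s).nat c = s.nat c) ∧
      (backwardStep.exec s).nat 1 = Function.update (s.nat 1) (i - 2) x ∧
      (backwardStep.exec s).nat 2 = Function.update (s.nat 2) (i - 2) y := by
  rw [backwardStep, Program.exec]
  rcases Program.exec_cond (.and (.natLe (cell 2) (.read 4 idx)) (.natLe (.read 4 idx) (cell 2)))
      (.seq (.setNat 1 (.sub idx (.const 2)) (.read 5 idx))
        (.setNat 2 (.sub idx (.const 2)) (.read 3 idx)))
      (.seq (.setNat 1 (.sub idx (.const 2)) (.read 7 idx))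
        (.setNat 2 (.sub idx (.const 2)) (.read 6 idx))) s with ⟨h, e⟩ | ⟨h, e⟩ <;>
    simp only [Test.Holds, NatExpr.eval, idx, cell, hi, ← le_antisymm_iff] at h
  · refine ⟨_, _, .inl ⟨h, rfl, rfl⟩, ?_⟩
    rw [e]
    refine ⟨?_, ?_, ?_, fun c hc => ?_, ?_, ?_⟩
    any_goals ext j
    case refine_4 =>
      have h₀ : c ≠ 0 ∧ c ≠ 1 ∧ c ≠ 2 := by omega
      simp [exec, State.writeNat, h₀]
    all_goals
      simp [exec, State.writeNat, NatExpr.eval, idx, cell, hi, Function.update_apply]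
  · refine ⟨_, _, .inr ⟨h, rfl, rfl⟩, ?_⟩
    rw [e]
    refine ⟨?_, ?_, ?_, fun c hc => ?_, ?_, ?_⟩
    any_goals ext j
    case refine_4 =>
      have h₀ : c ≠ 0 ∧ c ≠ 1 ∧ c ≠ 2 := by omega
      simp [exec, State.writeNat, h₀]
    all_goals
      simp [exec, State.writeNat, NatExpr.eval, idx, cell, hi, Function.update_apply]

/-- The effect of `listMate`. -/
theorem exec_listMate (hs : s.Stores q) {i : ℕ} (hi : s.nat 0 1 = i + 1) :
    (listMate.exec s).Stores q ∧
    (listMate.exec s).nat 0 0 = s.nat 0 0 ∧ (listMate.exec s).nat 0 1 = i ∧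
    (listMate.exec s).nat 1 = Function.update (s.nat 1) i i ∧
    (listMate.exec s).nat 2 = Function.update (s.nat 2) i (i + 1) ∧
    (listMate.exec s).real 2 0 = dist (q i) (q (i + 1)) - s.real 2 0 := by
  refine ⟨fun j => ?_, ?_, ?_, ?_, ?_, ?_⟩
  · simpa [listMate, exec, State.writeNat, State.writeReal] using hs j
  · simp [listMate, exec, State.writeNat, State.writeReal, NatExpr.eval, idx, cell]
  · simp [listMate, exec, State.writeNat, State.writeReal, NatExpr.eval, idx, cell, hi]
  · ext j
    simp [listMate, exec, State.writeNat, State.writeReal, NatExpr.eval, idx, cell, hi,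
      Function.update_apply]
  · ext j
    simp [listMate, exec, State.writeNat, State.writeReal, NatExpr.eval, idx, cell, hi,
      Function.update_apply]
  · simp only [listMate, exec, State.writeReal, RealExpr.eval]
    -- The distance is evaluated after three writes to the natural memory, which leave the
    -- coordinates intact.
    have e : ∀ s' : State, s'.real = s.real → ∀ x y : NatExpr, (distExpr x y).eval s' =
        dist (q (x.eval s')) (q (y.eval s')) := fun s' h =>
      State.Stores.eval_distExpr fun j => by rw [h]; exact hs j
    rw [e]
    swap
    · rfl
    simp [State.writeNat, NatExpr.eval, idx, cell, hi]

end RealRAM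

/-! ### Loop invariants, correctness and the linear time bound -/

namespace RealRAM

open BoundedAngle Program

variable {q : ℕ → Plane} {n t : ℕ}

/-- The invariant of the loop that lists the path edges. -/
structure ListInv (n : ℕ) (q : ℕ → Plane) (i : ℕ) (s : State) : Prop where
  stores : s.Stores q
  size : s.nat 0 0 = n
  index : s.nat 0 1 = i
  index_le : i ≤ n - 1
  mate : ∀ j, i ≤ j → j + 1 < n → s.nat 1 j = j ∧ s.nat 2 j = j + 1
  sum : s.real 2 0 = ∑ k ∈ Finset.Ico i (n - 1), (-1) ^ (k + i) * dist (q k) (q (k + 1))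

/-- The invariant of the loop that chooses the links. -/
structure ForwardInv (n t : ℕ) (q : ℕ → Plane) (i : ℕ) (s : State) : Prop where
  stores : s.Stores q
  size : s.nat 0 0 = n
  index : s.nat 0 1 = i
  index_le : i ≤ n
  index_mod : i % 2 = t
  mate : ∀ j, j + 1 < n → j % 2 ≠ t → s.nat 1 j = j ∧ s.nat 2 j = j + 1
  block : ∀ j ≤ i, j % 2 = t → IsBlock n j (s.nat 3 j) (s.nat 4 j)
  choice : ∀ j, j + 2 ≤ i → j % 2 = t → LinkChoice q (s.nat 3 j) (s.nat 4 j)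
    (s.nat 3 (j + 2)) (s.nat 4 (j + 2)) (s.nat 5 (j + 2)) (s.nat 6 (j + 2)) (s.nat 7 (j + 2))

/-- The invariant of the loop that lists the links. -/
structure BackwardInv (n t : ℕ) (q : ℕ → Plane) (i : ℕ) (s : State) : Prop where
  index : s.nat 0 1 = i
  index_le : i ≤ n
  index_mod : i % 2 = t
  mate : ∀ j, j + 1 < n → j % 2 ≠ t → s.nat 1 j = j ∧ s.nat 2 j = j + 1
  block : ∀ j ≤ n, j % 2 = t → IsBlock n j (s.nat 3 j) (s.nat 4 j)
  choice : ∀ j, j + 1 < n → j % 2 = t → LinkChoice q (s.nat 3 j) (s.nat 4 j)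
    (s.nat 3 (j + 2)) (s.nat 4 (j + 2)) (s.nat 5 (j + 2)) (s.nat 6 (j + 2)) (s.nat 7 (j + 2))
  used : s.nat 0 2 = s.nat 3 i ∨ s.nat 0 2 = s.nat 4 i
  used_eq : i + 1 < n → s.nat 1 i = s.nat 0 2
  link : ∀ j, i ≤ j → j + 1 < n → j % 2 = t →
    IsLink n q (s.nat 3) (s.nat 4) (s.nat 1) (s.nat 2) j

theorem ListInv.step {i : ℕ} {s : State} (h : ListInv n q (i + 1) s) :
    ListInv n q i (listMate.exec s) := by
  obtain ⟨h₁, h₂, h₃, h₄, h₅, h₆⟩ := exec_listMate h.stores h.index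
  have hi := h.index_le
  refine ⟨h₁, h₂.trans h.size, h₃, by omega, fun j hj hjn => ?_, ?_⟩
  · rw [h₄, h₅]
    by_cases hji : j = i
    · subst hji; simp
    · simpa [hji] using h.mate j (by omega) hjn
  -- Horner's rule: subtracting the old sum from the new length flips all its signs, as lowering `i`
  -- does in the exponent.
  · rw [h₆, h.sum, Finset.sum_eq_sum_Ico_succ_bot (show i < n - 1 by omega), ← two_mul,
      (even_two_mul i).neg_one_pow, one_mul, sub_eq_add_neg, ← Finset.sum_neg_distrib]
    congr 1
    refine Finset.sum_congr rfl fun k _ => ?_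
    rw [← add_assoc, pow_succ]
    ring

theorem ForwardInv.step {i : ℕ} {s : State} (h : ForwardInv n t q i s) (hi : i + 2 ≤ n) :
    ForwardInv n t q (i + 2) (forwardStep.exec s) := by
  obtain ⟨u, v, p, g, r, huv, hL, h₁, h₂, h₃, h₄, h₅, h₆, h₇, h₈, h₉⟩ :=
    exec_forwardStep h.stores h.size h.index
  have hit := h.index_mod
  refine ⟨fun j => by rw [h₁]; exact h.stores j, h₂, h₃, hi, by omega, fun j hj hjt => ?_,
    fun j hj hjt => ?_, fun j hj hjt => ?_⟩
  · rw [h₄ 1 (.inl rfl), h₄ 2 (.inr rfl)]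
    exact h.mate j hj hjt
  · rw [h₅, h₆]
    by_cases hji : j = i + 2
    · subst hji
      simpa [IsBlock] using huv
    · simpa [hji] using h.block j (by omega) hjt
  · rw [h₅, h₆, h₇, h₈, h₉]
    by_cases hji : j = i
    · subst hji
      simpa using hL
    · have hji' : j ≠ i + 2 := by omega
      simpa [hji, hji'] using h.choice j (by omega) hjt

/-- Only entry `i` of the output arrays changes, so links further right persist. The new link is
compatible with link `i + 2` by `LinkChoice.isLink`, and its left end becomes the used point of the
previous block. -/
theorem BackwardInv.step {i : ℕ} {s : State} (h : BackwardInv n t q (i + 2) s) :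
    BackwardInv n t q i (backwardStep.exec s) := by
  obtain ⟨x, y, hxy, -, h₁, h₂, h₃, h₄, h₅⟩ := exec_backwardStep h.index
  rw [Nat.add_sub_cancel] at h₁ h₄ h₅
  have hit := h.index_mod
  have hin := h.index_le
  have hc := h.choice i (by omega) (by omega)
  have ha : ∀ j, j ≠ i → (backwardStep.exec s).nat 1 j = s.nat 1 j := fun j hj => by
    rw [h₄, Function.update_of_ne hj]
  have hb : ∀ j, j ≠ i → (backwardStep.exec s).nat 2 j = s.nat 2 j := fun j hj => by
    rw [h₅, Function.update_of_ne hj]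
  have ha' : (backwardStep.exec s).nat 1 i = x := by rw [h₄, Function.update_self]
  have hb' : (backwardStep.exec s).nat 2 i = y := by rw [h₅, Function.update_self]
  refine ⟨h₁, by omega, by omega, fun j hj hjt => ?_, fun j hj hjt => ?_, fun j hj hjt => ?_, ?_,
    fun _ => ?_, fun j hj hjn hjt => ?_⟩
  · rw [ha j (by rintro rfl; omega), hb j (by rintro rfl; omega)]
    exact h.mate j hj hjt
  · rw [h₃ 3 le_rfl, h₃ 4 (by omega)]
    exact h.block j hj hjt
  · rw [h₃ 3 le_rfl, h₃ 4 (by omega), h₃ 5 (by omega), h₃ 6 (by omega), h₃ 7 (by omega)]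
    exact h.choice j hj hjt
  · rw [h₂, h₃ 3 le_rfl, h₃ 4 (by omega)]
    rcases hxy with ⟨-, -, rfl⟩ | ⟨-, -, rfl⟩
    · exact hc.fits.imp And.left And.left
    · exact hc.fits_alt.imp And.left And.left
  · rw [ha', h₂]
  · rw [h₃ 3 le_rfl, h₃ 4 (by omega)]
    by_cases hji : j = i
    · subst hji
      refine hc.isLink (h.block (j + 2) hin hit) h.used (fun hn => ?_) (fun hn => ?_) ?_
      · rw [ha _ (by omega)]
        exact h.used_eq (by omega)
      · rw [ha _ (by omega), hb _ (by omega)]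
        exact (h.link (j + 2) le_rfl (by omega) hit).fits
      · rw [ha', hb']
        exact hxy
    · have hl := h.link j (by omega) hjn hjt
      refine ⟨?_, ?_, ?_⟩
      · rw [ha j hji, hb j hji]; exact hl.fits
      · rw [ha j hji, hb j hji]; exact hl.wide
      · rw [ha j hji, hb j hji, ha (j + 2) (by omega), hb (j + 2) (by omega)]; exact hl.narrow

theorem BackwardInv.isLinkage {i : ℕ} {s : State} (h : BackwardInv n t q i s) (hi : i < 2) :
    IsLinkage n t q (s.nat 1) (s.nat 2) := by
  have hit := h.index_mod
  exact isLinkage_of_isLink (by omega) h.mate h.block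
    fun j hj hjt => h.link j (by omega) hj hjt

theorem ListInv.forwardInv {s : State} (h : ListInv n q 0 s) (hn : 1 ≤ n)
    (ht : t = if 0 ≤ ∑ k ∈ Finset.range (n - 1), (-1) ^ k * dist (q k) (q (k + 1)) then 0 else 1) :
    ForwardInv n t q t (initialBlock.exec s) := by
  have hsum := h.sum
  simp only [add_zero, ← Finset.range_eq_Ico] at hsum
  -- For a single point the alternating sum is empty, which selects parity `0`; otherwise `t ≤ 1 <
  -- n`.
  have htn : t < n := by
    split_ifs at ht with hs
    · omega
    · by_contra hcon
      have : n = 1 := by omega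
      subst this
      simp at hs
  have ht₂ : t < 2 := by split_ifs at ht <;> omega
  rw [← hsum] at ht
  have key : ∃ s₁ : State, s₁.nat 0 1 = t ∧ s₁.nat 0 0 = n ∧ s₁.real = s.real ∧
      s₁.nat 1 = s.nat 1 ∧ s₁.nat 2 = s.nat 2 ∧
      initialBlock.exec s = (s₁.writeNat 3 t (t - 1)).writeNat 4 t t := by
    rw [initialBlock, exec]
    rcases exec_cond (.realLe (.const 0) (.read 2 (.const 0))) .skip
      (.setNat 0 (.const 1) (.const 1)) s with ⟨hb, e⟩ | ⟨hb, e⟩ <;> rw [e] <;>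
      simp only [Test.Holds, RealExpr.eval, NatExpr.eval, Nat.cast_zero] at hb
    · rw [if_pos hb] at ht
      subst ht
      refine ⟨s, h.index, h.size, rfl, rfl, rfl, ?_⟩
      simp [exec, NatExpr.eval, idx, cell, State.writeNat, h.index]
    · rw [if_neg hb] at ht
      subst ht
      refine ⟨s.writeNat 0 1 1, by simp [State.writeNat], by simp [State.writeNat, h.size], rfl,
        by simp [State.writeNat], by simp [State.writeNat], ?_⟩
      simp [exec, NatExpr.eval, idx, cell, State.writeNat]
      rfl
  obtain ⟨s₁, h₁, h₂, h₃, h₄, h₅, e⟩ := key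
  rw [e]
  refine ⟨fun j => ?_, ?_, ?_, htn.le, Nat.mod_eq_of_lt ht₂, fun j hj hjt => ?_,
    fun j hj hjt => ?_, fun j hj hjt => ?_⟩
  · simpa [State.writeNat, h₃] using h.stores j
  · simp [State.writeNat, h₂]
  · simp [State.writeNat, h₁]
  · simpa [State.writeNat, h₄, h₅] using h.mate j (Nat.zero_le j) hj
  · obtain rfl : j = t := by omega
    simp [State.writeNat, IsBlock]
    omega
  · omega

/-- No link follows the last block, so its used point is arbitrary; naming the second one selects
the first option there. -/
theorem ForwardInv.backwardInv {i : ℕ} {s : State} (h : ForwardInv n t q i s) (hi : n < i + 2) :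
    BackwardInv n t q i (s.writeNat 0 2 (s.nat 4 i)) := by
  have hit := h.index_mod
  have hin := h.index_le
  refine ⟨?_, hin, hit, fun j hj hjt => ?_, fun j hj hjt => ?_, fun j hj hjt => ?_, ?_,
    fun hn => by omega, fun j hj hjn hjt => by omega⟩
  · simpa [State.writeNat] using h.index
  · simpa [State.writeNat] using h.mate j hj hjt
  · simpa [State.writeNat] using h.block j (by omega) hjt
  · simpa [State.writeNat] using h.choice j (by omega) hjt
  · simp [State.writeNat]

theorem loopFree_listMate : listMate.LoopFree := ⟨trivial, trivial, trivial, trivial⟩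

theorem loopFree_storeBlock (u v p g r : ℕ) : (storeBlock u v p g r).LoopFree :=
  ⟨trivial, trivial, trivial, trivial, trivial⟩

theorem loopFree_forwardStep : forwardStep.LoopFree := by
  simp [forwardStep, loadBlocks, chooseLink, LoopFree, loopFree_storeBlock]

theorem loopFree_initialBlock : initialBlock.LoopFree := by
  simp [initialBlock, LoopFree]

theorem loopFree_backwardStep : backwardStep.LoopFree := by
  simp [backwardStep, LoopFree]

/-- The number of steps of `spanningTree` for one point. -/
def stepBound : ℕ :=
  ((NatExpr.const 1).cost + (NatExpr.sub (cell 0) (.const 1)).cost + 1) +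
  ((Test.natLe (.const 1) idx).cost + listMate.bound + 1) + initialBlock.bound +
  2 * ((Test.natLe (.add idx (.const 2)) (cell 0)).cost + forwardStep.bound + 1) +
  ((NatExpr.const 2).cost + (NatExpr.read 4 idx).cost + 1) +
  2 * ((Test.natLe (.const 2) idx).cost + backwardStep.bound + 1)

theorem runs_spanningTree (hn : 1 ≤ n) {s : State} (hs : s.Stores q) (hsize : s.nat 0 0 = n)
    (hsum : s.real 2 0 = 0)
    (ht : t = if 0 ≤ ∑ k ∈ Finset.range (n - 1), (-1) ^ k * dist (q k) (q (k + 1)) then 0 else 1) :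
    ∃ (s' : State) (T : ℕ), Runs spanningTree s s' T ∧ T ≤ stepBound * n ∧
      IsLinkage n t q (s'.nat 1) (s'.nat 2) := by
  have h₀ : ListInv n q (n - 1) (s.writeNat 0 1 (n - 1)) := by
    refine ⟨hs, ?_, ?_, le_rfl, fun j hj hjn => by omega, ?_⟩
    · simpa [State.writeNat] using hsize
    · simp [State.writeNat]
    · simpa [State.writeNat] using hsum
  have r₀ : Runs (.setNat 0 (.const 1) (.sub (cell 0) (.const 1))) s
      (s.writeNat 0 1 (n - 1))
      ((NatExpr.const 1).cost + (NatExpr.sub (cell 0) (.const 1)).cost + 1) := by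
    have := Runs.setNat 0 (.const 1) (.sub (cell 0) (.const 1)) s
    simpa only [NatExpr.eval, cell, hsize] using this
  obtain ⟨s₁, t₁, i₁, r₁, ht₁, hb₁, h₁⟩ := loopFree_listMate.runs_loop (.natLe (.const 1) idx)
    (ListInv n q) (fun k s h hb => by
      simp only [Test.Holds, NatExpr.eval, idx, cell, h.index] at hb
      obtain ⟨k, rfl⟩ : ∃ k', k = k' + 1 := ⟨k - 1, by omega⟩
      exact ⟨k, by omega, h.step⟩) _ _ h₀
  simp only [Test.Holds, NatExpr.eval, idx, cell, h₁.index] at hb₁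
  obtain rfl : i₁ = 0 := by omega
  obtain ⟨t₂, r₂, ht₂⟩ := loopFree_initialBlock.runs s₁
  have h₂ := h₁.forwardInv hn ht
  obtain ⟨s₃, t₃, k₃, r₃, ht₃, hb₃, i₃, hk₃, h₃⟩ := loopFree_forwardStep.runs_loop
    (.natLe (.add idx (.const 2)) (cell 0))
    -- The index grows in this loop, so the decreasing counter is `n - i`.
    (fun k s => ∃ i, k + i = n ∧ ForwardInv n t q i s) (fun k s h hb => by
      obtain ⟨i, hki, h⟩ := h
      simp only [Test.Holds, NatExpr.eval, idx, cell, h.index, h.size] at hb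
      exact ⟨k - 2, by omega, i + 2, by omega, h.step hb⟩) _ _
      ⟨t, Nat.sub_add_cancel h₂.index_le, h₂⟩
  simp only [Test.Holds, NatExpr.eval, idx, cell, h₃.index, h₃.size, not_le] at hb₃
  have h₄ := h₃.backwardInv hb₃
  have r₄ : Runs (.setNat 0 (.const 2) (.read 4 idx)) s₃
      (s₃.writeNat 0 2 (s₃.nat 4 i₃))
      ((NatExpr.const 2).cost + (NatExpr.read 4 idx).cost + 1) := by
    have := Runs.setNat 0 (.const 2) (.read 4 idx) s₃
    simpa only [NatExpr.eval, idx, cell, h₃.index] using this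
  obtain ⟨s₅, t₅, i₅, r₅, ht₅, hb₅, h₅⟩ := loopFree_backwardStep.runs_loop (.natLe (.const 2) idx)
    (BackwardInv n t q) (fun k s h hb => by
      simp only [Test.Holds, NatExpr.eval, idx, cell, h.index] at hb
      obtain ⟨k, rfl⟩ : ∃ k', k = k' + 2 := ⟨k - 2, by omega⟩
      exact ⟨k, by omega, h.step⟩) _ _ h₄
  simp only [Test.Holds, NatExpr.eval, idx, cell, h₅.index, not_le] at hb₅
  refine ⟨s₅, _, .seq r₀ (.seq r₁ (.seq r₂ (.seq r₃ (.seq r₄ r₅)))), ?_, h₅.isLinkage hb₅⟩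
  have hin := h₃.index_le
  -- The loop counters start at `n - 1`, `n - t` and `i₃ ≤ n`; adding one for the final failing test
  -- leaves at most `n`, `2 * n` and `2 * n`.
  have b₁ : t₁ ≤ ((Test.natLe (.const 1) idx).cost + listMate.bound + 1) * n :=
    ht₁.trans (by rw [mul_comm]; exact Nat.mul_le_mul_left _ (by omega))
  have b₃ : t₃ ≤ ((Test.natLe (.add idx (.const 2)) (cell 0)).cost + forwardStep.bound + 1) *
      (2 * n) := ht₃.trans (by rw [mul_comm]; exact Nat.mul_le_mul_left _ (by omega))
  have b₅ : t₅ ≤ ((Test.natLe (.const 2) idx).cost + backwardStep.bound + 1) * (2 * n) :=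
    ht₅.trans (by rw [mul_comm]; exact Nat.mul_le_mul_left _ (by omega))
  rw [stepBound]
  generalize (Test.natLe (.const 1) idx).cost + listMate.bound + 1 = c₁ at *
  generalize (Test.natLe (.add idx (.const 2)) (cell 0)).cost + forwardStep.bound + 1 = c₃ at *
  generalize (Test.natLe (.const 2) idx).cost + backwardStep.bound + 1 = c₅ at *
  generalize initialBlock.bound = c₂ at *
  generalize (NatExpr.const 1).cost + (NatExpr.sub (cell 0) (.const 1)).cost + 1 = c₀
  generalize (NatExpr.const 2).cost + (NatExpr.read 4 idx).cost + 1 = c₄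
  nlinarith [Nat.mul_le_mul_left c₀ hn, Nat.mul_le_mul_left c₂ hn, Nat.mul_le_mul_left c₄ hn]

end RealRAM

/-! ### The main theorem -/

theorem mainTheorem1 :
    ∃ (A : RealRAM.Program) (C : ℕ), ∀ (n : ℕ), 1 ≤ n → ∀ p : Fin n → Plane, Function.Injective p →
      ∃ (s : RealRAM.State) (t : ℕ),
        RealRAM.Runs A (RealRAM.inputPoints p) s t ∧ t ≤ C * n ∧
        BoundedAngle.IsAngleSpanningTree (2 * Real.pi / 3) p (RealRAM.outputGraph n s) ∧
        BoundedAngle.graphWeight p (RealRAM.outputGraph n s) ≤ 2 * BoundedAngle.pathWeight p ∧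
        BoundedAngle.IsHopSpannerOfPath 3 (RealRAM.outputGraph n s) := by
  refine ⟨RealRAM.spanningTree, RealRAM.stepBound, fun n hn p hp => ?_⟩
  -- The padding by `0` matches the empty cells of the input, so `Stores` holds at every index.
  set q : ℕ → Plane := fun i => if h : i < n then p ⟨i, h⟩ else 0 with hq
  have hpq : p = fun i : Fin n => q i := by
    ext i : 1
    simp [hq]
  have hinj : ∀ i j, i < n → j < n → q i = q j → i = j := fun i j hi hj h => by
    simp only [hq, hi, hj, dif_pos] at h
    simpa using hp h
  have hstore : (RealRAM.inputPoints p).Stores q := fun i => by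
    by_cases h : i < n <;> simp [RealRAM.inputPoints, hq, h]
  obtain ⟨s, t, hr, ht, hT⟩ := RealRAM.runs_spanningTree hn hstore
    (by simp [RealRAM.inputPoints]) (by simp [RealRAM.inputPoints]) rfl
  refine ⟨s, t, hr, ht, ?_⟩
  rw [show RealRAM.outputGraph n s = BoundedAngle.listedGraph n (s.nat 1) (s.nat 2) from rfl, hpq]
  exact ⟨⟨hT.isTree hn, hT.angleBounded hinj⟩, hT.graphWeight_le_two_mul rfl, hT.isHopSpannerOfPath⟩
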